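/- Let $X$ and $U$ be (real or complex) Hilbert spaces, let $A:D(A)\to X$ generate a $C_0$ semigroup $(S(t))_{t\ge 0}$ on $X$, and let $B\in L(U,X)$. Consider the control system $\dot y=Ay+Bu$, whose solution with $y(0)=y_0\in X$ and control $u\in L^2(0,T;U)$ satisfies $y(T;y_0,u)=S(T)y_0+\int_0^T S(T-t)Bu(t)\,dt$. The system is exponentially stabilizable if there is $K\in L(X,U)$ such that $A+BK$ generates a $C_0$ semigroup $(S_K(t))_{t\ge0}$ with $\|S_K(t)\|\le Me^{\omega t}$ for all $t\ge 0$, for some $M\ge 1$ and $\omega<0$. For $K\in L(X,U)$ let $\omega_K\in[-\infty,\infty)$ be the growth bound of the semigroup $S_K$ generated by $A+BK$, i.e. the infimum of all $\omega\in\mathbb R$ such that $\|S_K(t)\|\le Me^{\omega t}$ for all $t\ge0$ for some $M\ge1$, and let $\omega^*=\inf_{K\in L(X,U)}\omega_K$ be the best stabilization decay rate. For $T>0$ let $G_T=\int_0^T S(T-t)BB^*S(T-t)^*\,dt$, write $\|B^*S(T-\cdot)^*\psi\|_{L^2(0,T;U)}=\big(\int_0^T\|B^*S(T-t)^*\psi\|_U^2\,dt\big)^{1/2}$,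 and for $\alpha>0$ and $y_0\in X$ set $$\mu_{y_0,\alpha}^T=\inf\{C\ge 0 \mid \operatorname{Re}\langle\psi,S(T)y_0\rangle-\alpha\|y_0\|\,\|\psi\|\le C\|G_T^{1/2}\psi\|\ \ \forall\psi\in X\}\in[0,\infty],\qquad \mu_\alpha^T=\sup_{\|y_0\|=1}\mu_{y_0,\alpha}^T\in[0,\infty]$$ (with $\inf\emptyset=+\infty$, and with value $0$ for the supremum if $X=\{0\}$). Theorem. The following are equivalent. (a) The system is exponentially stabilizable. (b) For every $\alpha\in(0,1)$ (equivalently, for some $\alpha\in(0,1)$) there exists $T>0$ such that $\mu_\alpha^T<\infty$. (c) For every $\alpha\in(0,1)$ (equivalently, for some $\alpha\in(0,1)$) there exist $T>0$ and $C>0$ such that for every $y_0\in X$ there exists $u\in L^2(0,T;U)$ with $$\|y(T;y_0,u)\|\le\alpha\|y_0\|\quad\text{and}\quad\|u\|_{L^2(0,T;U)}\le C\|y_0\|.\tag{1}$$ (d) For every $\alpha\in(0,1)$ (equivalently, for some $\alpha\in(0,1)$) there exist $T>0$ and $C>0$ such that $$\|S(T)^*\psi\|\le C\|B^*S(T-\cdot)^*\psi\|_{L^2(0,T;U)}+\alpha\|\psi\|\qquad\forall\psi\in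 X.\tag{2}$$ Moreover, let $\alpha\in(0,1)$ and $T>0$ be such that $\mu_\alpha^T<\infty$, or the property in (c) holds for $(\alpha,T)$ with some $C>0$, or the inequality in (d) holds for $(\alpha,T)$ with some $C>0$. Then $\mu_\alpha^T<\infty$, and $\mu_\alpha^T$ is the smallest constant $C\ge0$ such that for every $y_0\in X$ some $u\in L^2(0,T;U)$ satisfies (1), and also the smallest constant $C\ge 0$ for which (2) holds. Finally, if the system is exponentially stabilizable, then, in $[-\infty,\infty)$, $$\omega^*=\inf\Big\{\frac{\ln\alpha}{T}\ \Big|\ \alpha\in(0,1),\ T>0,\ \mu_\alpha^T<\infty\Big\}.$$ -/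

import Mathlib

open MeasureTheory Filter Topology
open scoped NNReal ENNReal InnerProduct

noncomputable section

namespace ControlSystem

variable {𝕜 X U : Type*} [RCLike 𝕜]
  [NormedAddCommGroup X] [InnerProductSpace 𝕜 X] [CompleteSpace X]
  [NormedAddCommGroup U] [InnerProductSpace 𝕜 U] [CompleteSpace U]

/-- `S` is a `C₀` semigroup of bounded operators on `X`. Only the operators `S t` with `0 ≤ t` are
constrained; the values of `S` at negative times are irrelevant and never used. -/
structure IsC0Semigroup (S : ℝ → X →L[𝕜] X) : Prop where
  map_zero : S 0 = ContinuousLinearMap.id 𝕜 X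
  map_add : ∀ s t : ℝ, 0 ≤ s → 0 ≤ t → S (s + t) = (S s).comp (S t)
  tendsto_zero : ∀ x : X, Tendsto (fun t : ℝ => S t x) (𝓝[>] 0) (𝓝 x)

/-- The (unbounded) operator `A : D(A) → X` is the infinitesimal generator of the `C₀` semigroup
`S`: `x ∈ D(A)` and `A x = y` exactly when `(S(t)x - x)/t → y` as `t → 0⁺`. -/
structure Generates (A : X →ₗ.[𝕜] X) (S : ℝ → X →L[𝕜] X) : Prop where
  isC0Semigroup : IsC0Semigroup S
  mem_graph_iff : ∀ x y : X, (x, y) ∈ A.graph ↔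
    Tendsto (fun t : ℝ => ((t : 𝕜)⁻¹) • (S t x - x)) (𝓝[>] 0) (𝓝 y)

/-- `‖S(t)‖ ≤ M e^{ωt}` for all `t ≥ 0`, for some `M ≥ 1`. -/
def HasGrowthRate (S : ℝ → X →L[𝕜] X) (ω : ℝ) : Prop :=
  ∃ M : ℝ, 1 ≤ M ∧ ∀ t : ℝ, 0 ≤ t → ‖S t‖ ≤ M * Real.exp (ω * t)

/-- The growth bound of a semigroup, the infimum of the `ω` with `‖S(t)‖ ≤ M e^{ωt}`. It may be
`-∞`, so it is taken in the extended reals. -/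
def growthBound (S : ℝ → X →L[𝕜] X) : EReal :=
  sInf {r : EReal | ∃ ω : ℝ, HasGrowthRate S ω ∧ r = (ω : EReal)}

/-- The closed-loop operator `A + BK`, with domain `D(A)`. -/
def closedLoop (A : X →ₗ.[𝕜] X) (B : U →L[𝕜] X) (K : X →L[𝕜] U) : X →ₗ.[𝕜] X :=
  ((B.comp K : X →L[𝕜] X) : X →ₗ[𝕜] X) +ᵥ A

/-- Exponential stabilizability of `ẏ = Ay + Bu`: for some bounded feedback `K`, the operator
`A + BK` generates an exponentially stable `C₀` semigroup. -/
def ExponentiallyStabilizable (A : X →ₗ.[𝕜] X) (B : U →L[𝕜] X) : Prop :=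
  ∃ (K : X →L[𝕜] U) (SK : ℝ → X →L[𝕜] X), Generates (closedLoop A B K) SK ∧
    ∃ ω : ℝ, ω < 0 ∧ HasGrowthRate SK ω

/-- The best stabilization decay rate `ω* = inf_K ω_K`, where `ω_K` is the growth bound of the
semigroup generated by `A + BK`. -/
def bestDecayRate (A : X →ₗ.[𝕜] X) (B : U →L[𝕜] X) : EReal :=
  sInf {r : EReal | ∃ (K : X →L[𝕜] U) (SK : ℝ → X →L[𝕜] X),
    Generates (closedLoop A B K) SK ∧ r = growthBound SK}

/-- The space `L²(0,T;U)` of controls. -/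
abbrev Control (U : Type*) [NormedAddCommGroup U] (T : ℝ) : Type _ :=
  Lp U 2 (volume.restrict (Set.Ioc (0 : ℝ) T))

/-- The state `y(T; y₀, u) = S(T) y₀ + ∫₀ᵀ S(T - t) B u(t) dt` reached at time `T`. -/
def endState (S : ℝ → X →L[𝕜] X) (B : U →L[𝕜] X) (T : ℝ) (y₀ : X) (u : Control U T) : X :=
  letI : NormedSpace ℝ X := NormedSpace.restrictScalars ℝ 𝕜 X
  S T y₀ + ∫ t in (0 : ℝ)..T, S (T - t) (B (u t))

/-- The observation norm `‖B* S(T - ·)* ψ‖_{L²(0,T;U)}`. -/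
def obsNorm (S : ℝ → X →L[𝕜] X) (B : U →L[𝕜] X) (T : ℝ) (ψ : X) : ℝ :=
  √(∫ t in (0 : ℝ)..T, ‖(B†) (((S (T - t))†) ψ)‖ ^ 2)

/-- The Gramian operator `G_T ψ = ∫₀ᵀ S(T - t) B B* S(T - t)* ψ dt`. -/
def gramian (S : ℝ → X →L[𝕜] X) (B : U →L[𝕜] X) (T : ℝ) (ψ : X) : X :=
  letI : NormedSpace ℝ X := NormedSpace.restrictScalars ℝ 𝕜 X
  ∫ t in (0 : ℝ)..T, S (T - t) (B ((B†) (((S (T - t))†) ψ)))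

/-- The norm `‖G_T^{1/2} ψ‖ = ⟨G_T ψ, ψ⟩^{1/2}` for the positive square root of the Gramian. -/
def gramianNorm (S : ℝ → X →L[𝕜] X) (B : U →L[𝕜] X) (T : ℝ) (ψ : X) : ℝ :=
  √(RCLike.re (inner 𝕜 (gramian S B T ψ) ψ))

/-- The constant `μ_{y₀,α}^T ∈ [0,∞]`: the infimum (`∞` if there is none) of the `C ≥ 0` with
`Re ⟨ψ, S(T) y₀⟩ - α ‖y₀‖ ‖ψ‖ ≤ C ‖G_T^{1/2} ψ‖` for all `ψ`. -/
def muAt (S : ℝ → X →L[𝕜] X) (B : U →L[𝕜] X) (T α : ℝ) (y₀ : X) : ℝ≥0∞ :=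
  sInf {c : ℝ≥0∞ | ∃ C : ℝ≥0, c = (C : ℝ≥0∞) ∧ ∀ ψ : X,
    RCLike.re (inner 𝕜 ψ (S T y₀)) - α * ‖y₀‖ * ‖ψ‖ ≤ (C : ℝ) * gramianNorm S B T ψ}

/-- The constant `μ_α^T = sup_{‖y₀‖ = 1} μ_{y₀,α}^T ∈ [0,∞]`. -/
def mu (S : ℝ → X →L[𝕜] X) (B : U →L[𝕜] X) (T α : ℝ) : ℝ≥0∞ :=
  ⨆ (y₀ : X) (_ : ‖y₀‖ = 1), muAt S B T α y₀

/-- Every `y₀` can be steered in time `T` to a state of norm at most `α ‖y₀‖`, by a control of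
`L²` norm at most `C ‖y₀‖`. -/
def SteersWithCost (S : ℝ → X →L[𝕜] X) (B : U →L[𝕜] X) (T α C : ℝ) : Prop :=
  ∀ y₀ : X, ∃ u : Control U T, ‖endState S B T y₀ u‖ ≤ α * ‖y₀‖ ∧ ‖u‖ ≤ C * ‖y₀‖

/-- The weak observability inequality `‖S(T)* ψ‖ ≤ C ‖B* S(T - ·)* ψ‖_{L²} + α ‖ψ‖`. -/
def WeakObservability (S : ℝ → X →L[𝕜] X) (B : U →L[𝕜] X) (T α C : ℝ) : Prop :=
  ∀ ψ : X, ‖((S T)†) ψ‖ ≤ C * obsNorm S B T ψ + α * ‖ψ‖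

end ControlSystem

end

/-! At a fixed pair `(α, T)`, finiteness of `mu`, steering at bounded cost and weak observability
are one condition seen through duality. Let `L` be the input map, so that `L† ψ = B† S(T - ·)† ψ`
and `L L†` is the Gramian. The set `S(T) y₀ + L(ball)` meets a given ball around `0` exactly when no
direction `ψ` separates them (`exists_norm_add_le_iff`). Optimising the separation inequality over
`y₀` replaces `Re ⟪ψ, S(T) y₀⟫` by `‖S(T)† ψ‖`, with the same constant throughout
(`steersWithCost_iff`, `mu_le_iff`).

A closed-loop semigroup with `‖S_K(τ)‖ ≤ α` steers by means of the control `K S_K(t) y₀`, by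
variation of constants; this gives steering from stabilizability.

The converse is linear-quadratic optimal control. Steering repeatedly with a factor `α < 1` and
concatenating the controls yields, from every `x`, a pair (state, control) in `L²(0, ∞)` of norm `≤
C' ‖x‖` (`exists_pair_of_steersWithCost`). The pair `Φ x` of least norm is the one orthogonal to all
pairs starting from `0`, hence is linear and bounded in `x` (`exists_optimalPair`). Tails of optimal
pairs are optimal, so the optimal states form a semigroup; the first variation of the norm
identifies the optimal control as the bounded feedback `-B† Φ† Φ` of the state
(`ae_control_eq_optimalFeedback`). The resulting closed loop is bounded
(`exists_bound_optimalFlow`).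

Decay comes from running this argument on `e^{δt} S(t)`, which is possible as long as `e^{δτ} α <
1`: undoing the rescaling turns boundedness into the rate `-δ`, for every `δ ≥ 0` below `-ln α / τ`.
Conversely a closed loop with `‖S_K(t)‖ ≤ M e^{ωt}` allows `α = M e^{ωτ}`, and `ln α / τ = ω + ln M
/ τ` tends to `ω`. These two facts give the formula for the best rate. -/

noncomputable section

set_option linter.unusedSectionVars false

namespace ControlSystem

/-! ### Strongly continuous semigroups: local bounds and joint continuity. -/

section Semigroup

variable {𝕜 X : Type*} [RCLike 𝕜] [NormedAddCommGroup X] [InnerProductSpace 𝕜 X]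

/-- A semigroup of operators, indexed by the whole real line, which is jointly continuous; the
semigroup law is only required for nonnegative times. -/
structure JointSemigroup (S : ℝ → X →L[𝕜] X) : Prop where
  map_zero : S 0 = ContinuousLinearMap.id 𝕜 X
  map_add : ∀ s t : ℝ, 0 ≤ s → 0 ≤ t → S (s + t) = (S s).comp (S t)
  continuous : Continuous fun p : ℝ × X => S p.1 p.2

theorem IsC0Semigroup.tendsto_zero' {S : ℝ → X →L[𝕜] X}
    (h : IsC0Semigroup S) (x : X) : Tendsto (fun s => S s x) (𝓝[≥] 0) (𝓝 x) := by
  rw [← Set.Ioi_insert, nhdsWithin_insert]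
  refine Tendsto.sup ?_ (h.tendsto_zero x)
  rw [tendsto_pure_left]
  intro s hs
  simpa [h.map_zero] using mem_of_mem_nhds hs

/-- Otherwise the norms blow up along some `t n → 0` although every orbit converges there, against
the uniform boundedness principle. -/
theorem IsC0Semigroup.exists_bound_near_zero [CompleteSpace X] {S : ℝ → X →L[𝕜] X}
    (h : IsC0Semigroup S) : ∃ δ > 0, ∃ M : ℝ, 1 ≤ M ∧ ∀ t, 0 ≤ t → t ≤ δ → ‖S t‖ ≤ M := by
  by_contra! hcon
  have h1 : ∀ n : ℕ, ∃ t : ℝ, 0 ≤ t ∧ t ≤ 1 / ((n : ℝ) + 1) ∧ (n : ℝ) + 1 < ‖S t‖ := fun n => by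
    obtain ⟨t, h0, h1, h2⟩ := hcon (1 / ((n : ℝ) + 1)) (by positivity) (n + 1) (by simp)
    exact ⟨t, h0, h1, h2⟩
  choose t ht0 ht1 ht2 using h1
  have hlim : Tendsto t atTop (𝓝 0) :=
    squeeze_zero ht0 ht1 tendsto_one_div_add_atTop_nhds_zero_nat
  obtain ⟨C, hC⟩ := banach_steinhaus (g := fun n => S (t n)) (fun x => by
    have : Tendsto (fun n => S (t n) x) atTop (𝓝 x) :=
      (h.tendsto_zero' x).comp (tendsto_nhdsWithin_iff.2 ⟨hlim, Eventually.of_forall ht0⟩)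
    obtain ⟨C, hC⟩ := this.norm.bddAbove_range
    exact ⟨C, fun n => hC ⟨n, rfl⟩⟩)
  obtain ⟨n, hn⟩ := exists_nat_gt C
  linarith [hC n, ht2 n]

theorem IsC0Semigroup.exists_bound [CompleteSpace X] {S : ℝ → X →L[𝕜] X}
    (h : IsC0Semigroup S) (T : ℝ) : ∃ M : ℝ, 1 ≤ M ∧ ∀ t, 0 ≤ t → t ≤ T → ‖S t‖ ≤ M := by
  obtain ⟨δ, hδ, M, hM, hb⟩ := h.exists_bound_near_zero
  have key : ∀ n : ℕ, ∀ t, 0 ≤ t → t ≤ n * δ → ‖S t‖ ≤ M ^ n := by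
    intro n
    induction n with
    | zero =>
      intro t h0 h1
      have : t = 0 := le_antisymm (by simpa using h1) h0
      subst this
      rw [h.map_zero, pow_zero]
      exact ContinuousLinearMap.norm_id_le
    | succ n ih =>
      intro t h0 h1
      push_cast at h1
      rcases le_total t δ with htd | htd
      · exact (hb t h0 htd).trans (le_self_pow₀ hM (by simp))
      · have := h.map_add δ (t - δ) hδ.le (by linarith)
        rw [add_sub_cancel] at this
        rw [this, pow_succ']
        exact (ContinuousLinearMap.opNorm_comp_le _ _).trans
          (mul_le_mul (hb δ hδ.le le_rfl) (ih _ (by linarith) (by linarith)) (norm_nonneg _)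
            (by linarith))
  obtain ⟨n, hn⟩ := exists_nat_ge (T / δ)
  refine ⟨M ^ n, one_le_pow₀ hM, fun t h0 h1 => key n t h0 (h1.trans ?_)⟩
  rwa [div_le_iff₀ hδ] at hn

/-- Factoring out `S s` reduces continuity at any time, from either side, to right continuity at
`0`. -/
theorem IsC0Semigroup.norm_sub_le {S : ℝ → X →L[𝕜] X} (h : IsC0Semigroup S) {T M : ℝ}
    (hM : ∀ t, 0 ≤ t → t ≤ T → ‖S t‖ ≤ M) {s t : ℝ} (hs : 0 ≤ s) (hst : s ≤ t) (ht : t ≤ T)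
    (x : X) : ‖S t x - S s x‖ ≤ M * ‖S (t - s) x - x‖ := by
  have h1 := h.map_add s (t - s) hs (by linarith)
  rw [add_sub_cancel] at h1
  have : S t x - S s x = S s (S (t - s) x - x) := by rw [h1]; simp
  rw [this]
  exact (S s).le_of_opNorm_le (hM s hs (by linarith)) _

/-- Freezing a `C₀` semigroup at negative times makes it jointly continuous. -/
theorem IsC0Semigroup.jointSemigroup [CompleteSpace X] {S : ℝ → X →L[𝕜] X}
    (h : IsC0Semigroup S) : JointSemigroup fun t => S (max t 0) where
  map_zero := by simpa using h.map_zero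
  map_add s t hs ht := by
    simp only [max_eq_left hs, max_eq_left ht, max_eq_left (add_nonneg hs ht)]
    exact h.map_add s t hs ht
  continuous := by
    rw [continuous_iff_continuousAt]
    rintro ⟨t₀, x₀⟩
    obtain ⟨M, hM1, hM⟩ := h.exists_bound (max t₀ 0 + 1)
    have hev : ∀ᶠ p : ℝ × X in 𝓝 (t₀, x₀), max p.1 0 ≤ max t₀ 0 + 1 := by
      have : Continuous fun p : ℝ × X => max p.1 0 := by fun_prop
      exact (this.tendsto (t₀, x₀)).eventually_le_const (by simp)
    rw [ContinuousAt, tendsto_iff_norm_sub_tendsto_zero]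
    have habs : Tendsto (fun p : ℝ × X => |max p.1 0 - max t₀ 0|) (𝓝 (t₀, x₀)) (𝓝[≥] 0) := by
      refine tendsto_nhdsWithin_iff.2 ⟨?_, Eventually.of_forall fun _ => Set.mem_Ici.2 (abs_nonneg _)⟩
      have : Continuous fun p : ℝ × X => |max p.1 0 - max t₀ 0| := by fun_prop
      simpa using this.tendsto (t₀, x₀)
    have hlim : Tendsto (fun p : ℝ × X => M * ‖p.2 - x₀‖ +
        M * ‖S |max p.1 0 - max t₀ 0| x₀ - x₀‖) (𝓝 (t₀, x₀)) (𝓝 (M * ‖x₀ - x₀‖ + M * ‖x₀ - x₀‖)) := by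
      refine Tendsto.add ?_ ?_
      · have : Continuous fun p : ℝ × X => M * ‖p.2 - x₀‖ := by fun_prop
        exact this.tendsto (t₀, x₀)
      · exact (((h.tendsto_zero' x₀).comp habs).sub_const x₀).norm.const_mul M
    simp only [sub_self, norm_zero, mul_zero, add_zero] at hlim
    refine squeeze_zero' (Eventually.of_forall fun _ => norm_nonneg _) ?_ hlim
    filter_upwards [hev] with p hp
    have e : S (max p.1 0) p.2 - S (max t₀ 0) x₀ =
      S (max p.1 0) (p.2 - x₀) + (S (max p.1 0) x₀ - S (max t₀ 0) x₀) := by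
      rw [map_sub]; abel
    rw [e]
    refine (norm_add_le _ _).trans (add_le_add ?_ ?_)
    · exact (S _).le_of_opNorm_le (hM _ (le_max_right _ _) hp) _
    · rcases le_total (max p.1 0) (max t₀ 0) with hle | hle
      · rw [norm_sub_rev, abs_sub_comm, abs_of_nonneg (by linarith)]
        exact h.norm_sub_le hM (le_max_right _ _) hle (by linarith) _
      · rw [abs_of_nonneg (by linarith)]
        exact h.norm_sub_le hM (le_max_right _ _) hle hp _

namespace JointSemigroup

variable {S : ℝ → X →L[𝕜] X}

theorem continuous_apply (h : JointSemigroup S) (x : X) : Continuous fun t => S t x :=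
  h.continuous.comp (by fun_prop : Continuous fun t : ℝ => (t, x))

theorem isC0Semigroup (h : JointSemigroup S) : IsC0Semigroup S where
  map_zero := h.map_zero
  map_add := h.map_add
  tendsto_zero x := by
    have := (h.continuous_apply x).tendsto 0
    rw [h.map_zero] at this
    exact this.mono_left nhdsWithin_le_nhds

theorem map_add_apply (h : JointSemigroup S) {s t : ℝ} (hs : 0 ≤ s) (ht : 0 ≤ t) (x : X) :
    S (s + t) x = S s (S t x) := by
  rw [h.map_add s t hs ht]; rfl

theorem apply_zero (h : JointSemigroup S) (x : X) : S 0 x = x := by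
  rw [h.map_zero]; rfl

/-- The rescaled semigroup `e^{δt} S(t)`. -/
theorem rescale (h : JointSemigroup S) (δ : ℝ) :
    JointSemigroup fun t => ((Real.exp (δ * t) : ℝ) : 𝕜) • S t where
  map_zero := by simp [h.map_zero]
  map_add s t hs ht := by
    ext x
    simp only [ContinuousLinearMap.comp_apply, smul_apply, map_smul,
      h.map_add_apply hs ht, smul_smul]
    rw [mul_add, Real.exp_add, RCLike.ofReal_mul]
    rw [mul_comm]
  continuous := by
    simp only [smul_apply]
    refine Continuous.smul ?_ h.continuous
    exact RCLike.continuous_ofReal.comp (by fun_prop)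

end JointSemigroup

end Semigroup

/-! ### Strong continuity of the adjoint semigroup. -/

section Adjoint

variable {𝕜 X : Type*} [RCLike 𝕜] [NormedAddCommGroup X] [InnerProductSpace 𝕜 X]
  [CompleteSpace X] [NormedSpace ℝ X]

/-- The integrand may depend on the upper limit `t` as well, which accommodates convolution kernels
`S (t - s)`. -/
theorem tendsto_average_of_continuous {E : Type*} [NormedAddCommGroup E] [NormedSpace ℝ E] [CompleteSpace E]
    {F : ℝ × ℝ → E} (hF : Continuous F) :
    Tendsto (fun t : ℝ => t⁻¹ • ∫ s in (0 : ℝ)..t, F (t, s)) (𝓝[>] 0) (𝓝 (F (0, 0))) := by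
  rw [Metric.tendsto_nhdsWithin_nhds]
  intro ε hε
  obtain ⟨δ, hδ, hd⟩ := Metric.continuousAt_iff.1 (hF.continuousAt (x := (0, 0))) (ε / 2) (by positivity)
  refine ⟨δ, hδ, fun t ht htd => ?_⟩
  have ht0 : 0 < t := ht
  have htd' : t < δ := by simpa [abs_of_pos ht0] using htd
  have hb : ∀ s ∈ Set.uIoc 0 t, ‖F (t, s) - F (0, 0)‖ ≤ ε / 2 := fun s hs => by
    rw [Set.uIoc_of_le ht0.le] at hs
    rw [← dist_eq_norm]
    refine (hd ?_).le
    rw [Prod.dist_eq]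
    simp [abs_of_pos ht0, abs_of_pos hs.1, htd', hs.2.trans_lt htd']
  have hI : IntervalIntegrable (fun s => F (t, s)) volume 0 t :=
    (hF.comp (by fun_prop : Continuous fun s : ℝ => (t, s))).intervalIntegrable _ _
  have e : t⁻¹ • (∫ s in (0 : ℝ)..t, F (t, s)) - F (0, 0) =
      t⁻¹ • ∫ s in (0 : ℝ)..t, (F (t, s) - F (0, 0)) := by
    rw [intervalIntegral.integral_sub hI (by simp), intervalIntegral.integral_const, smul_sub,
      sub_zero, smul_smul, inv_mul_cancel₀ ht0.ne', one_smul]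
  rw [dist_eq_norm, e, norm_smul, Real.norm_eq_abs, abs_of_pos (inv_pos.2 ht0)]
  have := intervalIntegral.norm_integral_le_of_norm_le_const hb
  rw [sub_zero, abs_of_pos ht0] at this
  calc t⁻¹ * _ ≤ t⁻¹ * (ε / 2 * t) := by gcongr
    _ = ε / 2 := by field_simp
    _ < ε := by linarith

/-- The operator `x ↦ ∫₀ʳ S(s) x ds`. -/
def JointSemigroup.primitive {S : ℝ → X →L[𝕜] X} (h : JointSemigroup S) (r : ℝ) : X →L[𝕜] X where
  toFun x := ∫ s in (0 : ℝ)..r, S s x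
  map_add' x y := by
    simp only [_root_.map_add]
    exact intervalIntegral.integral_add ((h.continuous_apply x).intervalIntegrable _ _)
      ((h.continuous_apply y).intervalIntegrable _ _)
  map_smul' c x := by
    simp only [map_smul, RingHom.id_apply]
    exact intervalIntegral.integral_smul c _
  cont := intervalIntegral.continuous_parametric_intervalIntegral_of_continuous'
    (f := fun x s => S s x) (h.continuous.comp continuous_swap) 0 r

theorem JointSemigroup.primitive_apply {S : ℝ → X →L[𝕜] X} (h : JointSemigroup S) (r : ℝ) (x : X) :
    h.primitive r x = ∫ s in (0 : ℝ)..r, S s x := rfl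

theorem JointSemigroup.tendsto_primitive {S : ℝ → X →L[𝕜] X} (h : JointSemigroup S) (x : X) :
    Tendsto (fun r : ℝ => r⁻¹ • h.primitive r x) (𝓝[>] 0) (𝓝 x) := by
  have := tendsto_average_of_continuous (F := fun p : ℝ × ℝ => S p.2 x)
    ((h.continuous_apply x).comp continuous_snd)
  simpa [h.apply_zero, h.primitive_apply] using this

/-- The difference consists of two integrals over intervals of length `t`. Being an estimate in
operator norm, it passes to adjoints, which strong convergence would not. -/
theorem JointSemigroup.norm_primitive_comp_sub_le {S : ℝ → X →L[𝕜] X} (h : JointSemigroup S)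
    {r t M : ℝ} (hr : 0 ≤ r) (ht : 0 ≤ t) (hM : ∀ s, 0 ≤ s → s ≤ r + t → ‖S s‖ ≤ M) :
    ‖(h.primitive r).comp (S t) - h.primitive r‖ ≤ 2 * M * t := by
  have hM0 : 0 ≤ M := (norm_nonneg _).trans (hM 0 le_rfl (by linarith))
  refine ContinuousLinearMap.opNorm_le_bound _ (by positivity) fun x => ?_
  have hc := fun a b => (h.continuous_apply x).intervalIntegrable (μ := volume) a b
  have e1 : h.primitive r (S t x) = ∫ s in t..(r + t), S s x := by
    have hsub := intervalIntegral.integral_comp_add_right (a := 0) (b := r) (fun s => S s x) t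
    rw [zero_add] at hsub
    rw [h.primitive_apply, ← hsub]
    refine intervalIntegral.integral_congr fun s hs => ?_
    rw [Set.uIcc_of_le hr] at hs
    exact (h.map_add_apply hs.1 ht x).symm
  have e2 : ((h.primitive r).comp (S t) - h.primitive r) x =
      (∫ s in r..(r + t), S s x) - ∫ s in (0 : ℝ)..t, S s x := by
    simp only [sub_apply, ContinuousLinearMap.comp_apply, e1]
    rw [h.primitive_apply, ← intervalIntegral.integral_add_adjacent_intervals (hc t r) (hc r _),
      ← intervalIntegral.integral_add_adjacent_intervals (hc 0 t) (hc t r)]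
    abel
  have b : ∀ a, 0 ≤ a → a ≤ r → ‖∫ s in a..(a + t), S s x‖ ≤ M * ‖x‖ * t := fun a ha har => by
    have := intervalIntegral.norm_integral_le_of_norm_le_const (a := a) (b := a + t)
      (f := fun s => S s x) (C := M * ‖x‖) (fun s hs => by
        rw [Set.uIoc_of_le (by linarith)] at hs
        exact (S s).le_of_opNorm_le (hM s (by linarith [hs.1]) (by linarith [hs.2])) x)
    simpa [abs_of_nonneg ht] using this
  rw [e2]
  have b0 := b 0 le_rfl hr
  rw [zero_add] at b0
  calc _ ≤ _ := _root_.norm_sub_le _ _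
    _ ≤ M * ‖x‖ * t + M * ‖x‖ * t := add_le_add (b r hr le_rfl) b0
    _ = _ := by ring

theorem IsC0Semigroup.of_bounded_of_dense {S : ℝ → X →L[𝕜] X} (h0 : S 0 = ContinuousLinearMap.id 𝕜 X)
    (hadd : ∀ s t : ℝ, 0 ≤ s → 0 ≤ t → S (s + t) = (S s).comp (S t)) {M : ℝ}
    (hM : ∀ t, 0 ≤ t → t ≤ 1 → ‖S t‖ ≤ M) (D : Set X) (hD : Dense D)
    (hlim : ∀ x ∈ D, Tendsto (fun t : ℝ => S t x) (𝓝[>] 0) (𝓝 x)) : IsC0Semigroup S where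
  map_zero := h0
  map_add := hadd
  tendsto_zero x := by
    have hM0 : 0 ≤ M := (norm_nonneg _).trans (hM 0 le_rfl (by norm_num))
    rw [Metric.tendsto_nhds]
    intro ε hε
    obtain ⟨y, hyD, hy⟩ := Metric.dense_iff.1 hD x (ε / (2 * (M + 1))) (by positivity)
    have h1 := (Metric.tendsto_nhds.1 (hlim _ hy)) (ε / 2) (by positivity)
    have h2 : ∀ᶠ t : ℝ in 𝓝[>] 0, t ∈ Set.Ioo (0 : ℝ) 1 := Ioo_mem_nhdsGT one_pos
    filter_upwards [h1, h2] with t ht1 ht2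
    rw [Metric.mem_ball, dist_comm, dist_eq_norm] at hyD
    rw [dist_eq_norm] at ht1 ⊢
    have e : S t x - x = S t (x - y) + (S t y - y) - (x - y) := by rw [map_sub]; abel
    have b1 : ‖S t (x - y)‖ ≤ M * ‖x - y‖ := (S t).le_of_opNorm_le (hM t ht2.1.le ht2.2.le) _
    have b2 : (M + 1) * ‖x - y‖ < ε / 2 := by
      rw [lt_div_iff₀ (by positivity)] at hyD
      linarith
    rw [e]
    have := _root_.norm_sub_le (S t (x - y) + (S t y - y)) (x - y)
    have := norm_add_le (S t (x - y)) (S t y - y)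
    linarith

/-- On a Hilbert space the adjoint of a `C₀` semigroup is a `C₀` semigroup. -/
theorem JointSemigroup.isC0Semigroup_adjoint {S : ℝ → X →L[𝕜] X} (h : JointSemigroup S) :
    IsC0Semigroup fun t => (S t)† := by
  obtain ⟨M, -, hM⟩ := h.isC0Semigroup.exists_bound 2
  -- The adjoint orbits of vectors in `D` converge by the operator-norm estimate. `D` is dense: a
  -- vector orthogonal to it is killed by every `primitive r` with `0 < r < 1`, yet is the limit of
  -- `r⁻¹ • primitive r x`.
  let D : Submodule 𝕜 X := ⨆ r : Set.Ioo (0 : ℝ) 1, LinearMap.range ((h.primitive r.1)† : X →ₗ[𝕜] X)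
  have hD : Dense (D : Set X) := by
    rw [Submodule.dense_iff_topologicalClosure_eq_top, Submodule.topologicalClosure_eq_top_iff,
      Submodule.eq_bot_iff]
    intro x hx
    have hz : ∀ r ∈ Set.Ioo (0 : ℝ) 1, h.primitive r x = 0 := fun r hr => by
      refine ext_inner_left 𝕜 fun v => ?_
      rw [inner_zero_right, ← ContinuousLinearMap.adjoint_inner_left]
      exact hx _ (Submodule.mem_iSup_of_mem ⟨r, hr⟩ ⟨v, rfl⟩)
    refine tendsto_nhds_unique (h.tendsto_primitive x) ?_
    refine tendsto_const_nhds.congr' ?_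
    filter_upwards [Ioo_mem_nhdsGT one_pos] with r hr
    rw [hz r hr, smul_zero]
  refine IsC0Semigroup.of_bounded_of_dense (M := M) ?_ ?_ ?_ D hD ?_
  · rw [h.map_zero]; exact ContinuousLinearMap.adjoint_id
  · intro s t hs ht
    rw [add_comm, h.map_add t s ht hs, ContinuousLinearMap.adjoint_comp]
  · intro t h0 h1
    simpa using hM t h0 (by linarith)
  · intro x hx
    induction hx using Submodule.iSup_induction' with
    | mem r x hx =>
      obtain ⟨v, rfl⟩ := hx
      obtain ⟨r, hr⟩ := r
      rw [tendsto_iff_norm_sub_tendsto_zero]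
      have hl : Tendsto (fun t : ℝ => 2 * M * t * ‖v‖) (𝓝[>] 0) (𝓝 0) := by
        have : Continuous fun t : ℝ => 2 * M * t * ‖v‖ := by fun_prop
        have := this.tendsto 0
        simp only [mul_zero, zero_mul] at this
        exact this.mono_left nhdsWithin_le_nhds
      refine squeeze_zero' (Eventually.of_forall fun _ => norm_nonneg _) ?_ hl
      filter_upwards [Ioo_mem_nhdsGT one_pos] with t ht
      have e : ((S t)†) (((h.primitive r)†) v) - ((h.primitive r)†) v =
          (((h.primitive r).comp (S t) - h.primitive r)†) v := by
        rw [map_sub, ContinuousLinearMap.adjoint_comp]; rfl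
      have := h.norm_primitive_comp_sub_le hr.1.le ht.1.le (M := M)
        (fun s h0 h1 => hM s h0 (by linarith [hr.2, ht.2]))
      refine (congrArg norm e).le.trans (ContinuousLinearMap.le_of_opNorm_le _ ?_ _)
      rwa [LinearIsometryEquiv.norm_map]
    | zero => simp
    | add x y _ _ hx hy => simpa using hx.add hy

end Adjoint

/-! ### Mild solutions of the inhomogeneous equation. -/

section Mild

variable {𝕜 X : Type*} [RCLike 𝕜] [NormedAddCommGroup X] [InnerProductSpace 𝕜 X]
  [CompleteSpace X] [NormedSpace ℝ X]

/-- The mild solution `t ↦ S(t) x + ∫₀ᵗ S(t - s) g(s) ds` of `ẏ = Ay + g`, `y(0) = x`. -/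
def mild (S : ℝ → X →L[𝕜] X) (x : X) (g : ℝ → X) (t : ℝ) : X :=
  S t x + ∫ s in (0 : ℝ)..t, S (t - s) (g s)

variable {S : ℝ → X →L[𝕜] X}

theorem JointSemigroup.integrableOn_comp (h : JointSemigroup S) {g : ℝ → X} {I : Set ℝ}
    (hI : MeasurableSet I) (hg : IntegrableOn g I) {t M : ℝ}
    (hM : ∀ s ∈ I, ‖S (t - s)‖ ≤ M) : IntegrableOn (fun s => S (t - s) (g s)) I := by
  refine Integrable.mono' (hg.norm.const_mul M) ?_ ?_
  · exact h.continuous.comp_aestronglyMeasurable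
      (((continuous_const.sub continuous_id).aestronglyMeasurable).prodMk hg.aestronglyMeasurable)
  · filter_upwards [ae_restrict_mem hI] with s hs
    exact (S _).le_of_opNorm_le (hM s hs) _

theorem JointSemigroup.intervalIntegrable_comp (h : JointSemigroup S) {g : ℝ → X} {a b t : ℝ}
    (hab : a ≤ b) (hbt : b ≤ t) (hg : IntegrableOn g (Set.Ioc a b)) :
    IntervalIntegrable (fun s => S (t - s) (g s)) volume a b := by
  rw [intervalIntegrable_iff_integrableOn_Ioc_of_le hab]
  obtain ⟨M, -, hM⟩ := h.isC0Semigroup.exists_bound (t - a)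
  exact h.integrableOn_comp measurableSet_Ioc hg
    (fun s hs => hM _ (by linarith [hs.2]) (by linarith [hs.1]))

theorem norm_mild_le (x : X) {g : ℝ → X} {t M : ℝ}
    (ht : 0 ≤ t) (hg : IntegrableOn g (Set.Ioc 0 t)) (hM : ∀ s, 0 ≤ s → s ≤ t → ‖S s‖ ≤ M) :
    ‖mild S x g t‖ ≤ M * ‖x‖ + M * ∫ s in (0 : ℝ)..t, ‖g s‖ := by
  refine (norm_add_le _ _).trans (add_le_add ((S t).le_of_opNorm_le (hM t ht le_rfl) x) ?_)
  rw [← intervalIntegral.integral_const_mul]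
  refine intervalIntegral.norm_integral_le_of_norm_le ht ?_ ?_
  · exact Eventually.of_forall fun s hs =>
      (S _).le_of_opNorm_le (hM _ (by linarith [hs.2]) (by linarith [hs.1])) _
  · rw [intervalIntegrable_iff_integrableOn_Ioc_of_le ht]
    exact hg.norm.const_mul M

/-- The input before time `s` acts only through the state at `s`: the semigroup law pulls `S t` out
of the integral over `(0, s]`, and a translation treats the rest. -/
theorem JointSemigroup.mild_add_time (h : JointSemigroup S) (x : X) {g : ℝ → X} {s t : ℝ}
    (hs : 0 ≤ s) (ht : 0 ≤ t) (hg : IntegrableOn g (Set.Ioc 0 (t + s))) :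
    mild S x g (t + s) = mild S (mild S x g s) (fun r => g (r + s)) t := by
  have h1 := h.intervalIntegrable_comp (t := t + s) hs (by linarith)
    (hg.mono_set (Set.Ioc_subset_Ioc_right (by linarith)))
  have h2 := h.intervalIntegrable_comp (t := t + s) (a := s) (by linarith) le_rfl
    (hg.mono_set (Set.Ioc_subset_Ioc_left (by linarith)))
  have h3 := h.intervalIntegrable_comp (t := s) hs le_rfl
    (hg.mono_set (Set.Ioc_subset_Ioc_right (by linarith)))
  simp only [mild]
  rw [_root_.map_add, ← h.map_add_apply ht hs, add_assoc,
    ← intervalIntegral.integral_add_adjacent_intervals h1 h2,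
    ← ContinuousLinearMap.intervalIntegral_comp_comm _ h3]
  congr 2
  · refine intervalIntegral.integral_congr fun r hr => ?_
    rw [Set.uIcc_of_le hs] at hr
    rw [← h.map_add_apply ht (by linarith [hr.2]), add_sub_assoc]
  · have := intervalIntegral.integral_comp_add_right (a := 0) (b := t)
      (fun r => S (t + s - r) (g r)) s
    rw [zero_add] at this
    rw [← this]
    refine intervalIntegral.integral_congr fun r _ => ?_
    simp only [add_sub_add_right_eq_sub]

/-- Over the fixed interval `Ioc 0 T`, with an indicator cutting off at `t`, the integrand is
continuous in `t` at `t₀` for every `s ≠ t₀`; dominated convergence with bound `M * ‖g s‖`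
concludes. -/
theorem JointSemigroup.continuousOn_mild (h : JointSemigroup S) (x : X) {g : ℝ → X} {T : ℝ}
    (hg : IntegrableOn g (Set.Ioc 0 T)) : ContinuousOn (mild S x g) (Set.Icc 0 T) := by
  refine (h.continuous_apply x).continuousOn.add ?_
  obtain ⟨M, -, hM⟩ := h.isC0Semigroup.exists_bound T
  have e : ∀ t ∈ Set.Icc 0 T, ∫ s in (0 : ℝ)..t, S (t - s) (g s) =
      ∫ s in Set.Ioc 0 T, (Set.Ioc 0 t).indicator (fun s => S (t - s) (g s)) s := fun t ht => by
    rw [setIntegral_indicator measurableSet_Ioc, intervalIntegral.integral_of_le ht.1,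
      Set.Ioc_inter_Ioc, max_self, min_eq_right ht.2]
  refine ContinuousOn.congr ?_ e
  intro t₀ ht₀
  refine continuousWithinAt_of_dominated (bound := fun s => M * ‖g s‖) ?_ ?_ (hg.norm.const_mul M) ?_
  · refine Eventually.of_forall fun t => AEStronglyMeasurable.indicator ?_ measurableSet_Ioc
    exact h.continuous.comp_aestronglyMeasurable
      (((continuous_const.sub continuous_id).aestronglyMeasurable).prodMk hg.aestronglyMeasurable)
  · filter_upwards [self_mem_nhdsWithin] with t ht
    refine Eventually.of_forall fun s => ?_
    have ht : t ∈ Set.Icc 0 T := ht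
    have hM0 : 0 ≤ M := (norm_nonneg _).trans (hM 0 le_rfl (ht.1.trans ht.2))
    by_cases hs : s ∈ Set.Ioc 0 t
    · rw [Set.indicator_of_mem hs]
      exact (S _).le_of_opNorm_le (hM _ (by linarith [hs.2]) (by linarith [hs.1, ht.2])) _
    · rw [Set.indicator_of_notMem hs, norm_zero]
      positivity
  · have hne : ∀ᵐ s ∂(volume.restrict (Set.Ioc 0 T)), s ≠ t₀ :=
      ae_restrict_of_ae (by simp [ae_iff])
    filter_upwards [hne, ae_restrict_mem measurableSet_Ioc] with s hs hsT
    refine ContinuousAt.continuousWithinAt ?_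
    have hc : Continuous fun t => S (t - s) (g s) :=
      (h.continuous_apply (g s)).comp (continuous_id.sub continuous_const)
    rcases lt_or_gt_of_ne hs with hlt | hgt
    · refine hc.continuousAt.congr ?_
      filter_upwards [eventually_gt_nhds hlt] with t ht
      rw [Set.indicator_of_mem (show s ∈ Set.Ioc 0 t from ⟨hsT.1, ht.le⟩)]
    · refine (continuousAt_const (y := (0 : X))).congr ?_
      filter_upwards [eventually_lt_nhds hgt] with t ht
      rw [Set.indicator_of_notMem (fun hh => absurd hh.2 (not_le.2 ht))]

end Mild

/-! ### Convex duality: reaching a ball versus an inequality for the adjoint. -/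

section Duality

variable {𝕜 X V : Type*} [RCLike 𝕜]
  [NormedAddCommGroup X] [InnerProductSpace 𝕜 X] [CompleteSpace X]
  [NormedAddCommGroup V] [InnerProductSpace 𝕜 V] [CompleteSpace V]

/-- A vector `p` with `|⟪p, ψ⟫| ≤ c ‖L† ψ‖` for all `ψ` is the image of a vector of norm at most
`c`. -/
theorem exists_preimage_of_norm_inner_le (L : V →L[𝕜] X) (p : X) {c : ℝ} (hc : 0 ≤ c)
    (hp : ∀ ψ : X, ‖inner 𝕜 p ψ‖ ≤ c * ‖(L†) ψ‖) : ∃ u : V, L u = p ∧ ‖u‖ ≤ c := by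
  let A : X →ₗ[𝕜] V := (L† : X →L[𝕜] V)
  obtain ⟨g, hg⟩ := A.rangeRestrict.exists_rightInverse_of_surjective A.range_rangeRestrict
  have hg' : ∀ v : LinearMap.range A, (L†) (g v) = v := fun v =>
    congrArg Subtype.val (LinearMap.congr_fun hg v)
  -- The functional `L† ψ ↦ ⟪p, ψ⟫` on the range of `L†`, bounded by `c`; its norm-preserving
  -- extension is represented by the desired `u`.
  let φ₀ : LinearMap.range A →ₗ[𝕜] 𝕜 := (innerSL 𝕜 p : X →ₗ[𝕜] 𝕜).comp g
  have hφ₀ : ∀ v, ‖φ₀ v‖ ≤ c * ‖v‖ := fun v => by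
    have := hp (g v)
    rw [hg'] at this
    exact this
  obtain ⟨φ, hφ, hn⟩ := exists_extension_norm_eq (LinearMap.range A) (φ₀.mkContinuous c hφ₀)
  refine ⟨(InnerProductSpace.toDual 𝕜 V).symm φ, ?_, ?_⟩
  · refine ext_inner_right 𝕜 fun ψ => ?_
    rw [← ContinuousLinearMap.adjoint_inner_right, InnerProductSpace.toDual_symm_apply]
    have h1 : φ ((L†) ψ) = inner 𝕜 p (g ⟨(L†) ψ, ⟨ψ, rfl⟩⟩) := hφ ⟨(L†) ψ, ⟨ψ, rfl⟩⟩
    -- The difference of two preimages lies in the kernel of `L†`, where `hp` forces `⟪p, ·⟫` to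
    -- vanish, so the choice of `g` does not matter.
    have h2 := hp (g ⟨(L†) ψ, ⟨ψ, rfl⟩⟩ - ψ)
    rw [_root_.map_sub, hg', sub_self, norm_zero, mul_zero, inner_sub_right] at h2
    rw [h1]
    exact sub_eq_zero.1 (norm_le_zero_iff.1 h2)
  · rw [LinearIsometryEquiv.norm_map, hn]
    exact LinearMap.mkContinuous_norm_le _ hc _

/-- For the converse, let `p` be the point nearest to `-b` in the closure of the image of the
`c`-ball. The direction `ψ = b + p` separates: the projection inequality gives `Re ⟪ψ, p⟫ ≤ -c ‖L†
ψ‖`, and the hypothesis at this `ψ` then yields `‖ψ‖² ≤ a ‖ψ‖`. A priori `p` is only a limit of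
images, but `‖⟪p, ψ⟫‖ ≤ c ‖L† ψ‖` survives the limit and `exists_preimage_of_norm_inner_le` produces
a genuine preimage. -/
theorem exists_norm_add_le_iff (L : V →L[𝕜] X) (b : X) {a c : ℝ} (ha : 0 ≤ a) (hc : 0 ≤ c) :
    (∃ u : V, ‖b + L u‖ ≤ a ∧ ‖u‖ ≤ c) ↔
      ∀ ψ : X, RCLike.re (inner 𝕜 ψ b) - a * ‖ψ‖ ≤ c * ‖(L†) ψ‖ := by
  constructor
  · rintro ⟨u, hu1, hu2⟩ ψ
    have e : RCLike.re (inner 𝕜 ψ b) =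
        RCLike.re (inner 𝕜 ψ (b + L u)) - RCLike.re (inner 𝕜 ((L†) ψ) u) := by
      rw [ContinuousLinearMap.adjoint_inner_left, inner_add_right, _root_.map_add]; ring
    have h1 : RCLike.re (inner 𝕜 ψ (b + L u)) ≤ ‖ψ‖ * ‖b + L u‖ := re_inner_le_norm _ _
    have h2 : |RCLike.re (inner 𝕜 ((L†) ψ) u)| ≤ ‖(L†) ψ‖ * ‖u‖ :=
      (RCLike.abs_re_le_norm _).trans (norm_inner_le_norm _ _)
    have h3 := mul_le_mul_of_nonneg_left hu1 (norm_nonneg ψ)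
    have h4 := mul_le_mul_of_nonneg_left hu2 (norm_nonneg ((L†) ψ))
    have h5 := neg_abs_le (RCLike.re (inner 𝕜 ((L†) ψ) u))
    rw [e]
    linarith
  · intro hψ
    let _ : InnerProductSpace ℝ X := InnerProductSpace.rclikeToReal 𝕜 X
    let _ : InnerProductSpace ℝ V := InnerProductSpace.rclikeToReal 𝕜 V
    let K : Set X := closure (L '' Metric.closedBall 0 c)
    have hKc : Convex ℝ K :=
      ((convex_closedBall (0 : V) c).linear_image ((L : V →ₗ[𝕜] X).restrictScalars ℝ)).closure
    obtain ⟨p, hpK, hp⟩ := exists_norm_eq_iInf_of_complete_convex (K := K)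
      ⟨0, subset_closure ⟨0, by simpa using hc, map_zero L⟩⟩ isClosed_closure.isComplete hKc (-b)
    rw [norm_eq_iInf_iff_real_inner_le_zero hKc hpK] at hp
    have hp' : ∀ u : V, ‖u‖ ≤ c →
        RCLike.re (inner 𝕜 (b + p) p) ≤ RCLike.re (inner 𝕜 ((L†) (b + p)) u) := fun u hu => by
      have := hp (L u) (subset_closure ⟨u, by simpa using hu, rfl⟩)
      rw [real_inner_eq_re_inner 𝕜, show -b - p = -(b + p) by abel, inner_neg_left, inner_sub_right,
        ← ContinuousLinearMap.adjoint_inner_left, _root_.map_neg, _root_.map_sub] at this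
      linarith
    have hle : RCLike.re (inner 𝕜 (b + p) p) ≤ -(c * ‖(L†) (b + p)‖) := by
      by_cases h0 : (L†) (b + p) = 0
      · simpa [h0] using hp' 0 (by simpa using hc)
      · have hn : ‖(L†) (b + p)‖ ≠ 0 := norm_ne_zero_iff.2 h0
        -- This vector minimises `Re ⟪L† (b + p), u⟫` over the ball of radius `c`.
        have := hp' (-((c / ‖(L†) (b + p)‖ : ℝ) : 𝕜) • (L†) (b + p)) (by
          rw [norm_smul, norm_neg, RCLike.norm_ofReal, abs_of_nonneg (by positivity),
            div_mul_cancel₀ _ hn])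
        rw [inner_smul_right, inner_self_eq_norm_sq_to_K, ← RCLike.ofReal_neg,
          RCLike.re_ofReal_mul, ← RCLike.ofReal_pow, RCLike.ofReal_re] at this
        refine this.trans (le_of_eq ?_)
        field_simp
    have hbp : ‖b + p‖ ≤ a := by
      have h1 := hψ (b + p)
      have h2 : ‖b + p‖ ^ 2 = RCLike.re (inner 𝕜 (b + p) b) + RCLike.re (inner 𝕜 (b + p) p) := by
        rw [← _root_.map_add, ← inner_add_right, inner_self_eq_norm_sq]
      rcases (norm_nonneg (b + p)).eq_or_lt' with h0 | h0
      · rw [h0]; exact ha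
      · nlinarith
    have hpL : ∀ ψ : X, ‖inner 𝕜 p ψ‖ ≤ c * ‖(L†) ψ‖ := fun ψ => by
      refine closure_minimal (s := L '' Metric.closedBall 0 c)
        (t := {q : X | ‖inner 𝕜 q ψ‖ ≤ c * ‖(L†) ψ‖}) ?_ ?_ hpK
      · rintro _ ⟨u, hu, rfl⟩
        rw [Set.mem_ofPred_eq, ← ContinuousLinearMap.adjoint_inner_right]
        exact (norm_inner_le_norm _ _).trans
          (mul_le_mul_of_nonneg_right (by simpa using hu) (norm_nonneg _))
      · exact isClosed_le (by fun_prop) continuous_const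
    obtain ⟨u, rfl, hu⟩ := exists_preimage_of_norm_inner_le L p hc hpL
    exact ⟨u, hbp, hu⟩

end Duality

/-! ### The input map, its adjoint, and the equivalence of the three costs. -/

section InputMap

theorem integral_norm_le_sqrt_mul_eLpNorm {U : Type*} [NormedAddCommGroup U] {u : ℝ → U} {a b : ℝ}
    (hab : a ≤ b) (hu : MemLp u 2 (volume.restrict (Set.Ioc a b))) :
    ∫ s in a..b, ‖u s‖ ≤ √(b - a) * (eLpNorm u 2 (volume.restrict (Set.Ioc a b))).toReal := by
  rw [intervalIntegral.integral_of_le hab, integral_norm_eq_lintegral_enorm hu.1,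
    ← eLpNorm_one_eq_lintegral_enorm]
  have h := eLpNorm_le_eLpNorm_mul_rpow_measure_univ (p := 1) (q := 2) one_le_two hu.1
  have hne : eLpNorm u 2 (volume.restrict (Set.Ioc a b)) *
      volume.restrict (Set.Ioc a b) Set.univ ^ (1 / (1 : ℝ≥0∞).toReal - 1 / (2 : ℝ≥0∞).toReal) ≠ ⊤ := by
    refine ENNReal.mul_ne_top hu.2.ne (ENNReal.rpow_ne_top_of_nonneg (by norm_num) ?_)
    simp
  refine (ENNReal.toReal_mono hne h).trans (le_of_eq ?_)
  rw [ENNReal.toReal_mul, mul_comm, ← ENNReal.toReal_rpow, Measure.restrict_apply_univ,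
    Real.volume_Ioc, ENNReal.toReal_ofReal (by linarith), Real.sqrt_eq_rpow]
  norm_num

variable {𝕜 X U : Type*} [RCLike 𝕜]
  [NormedAddCommGroup X] [InnerProductSpace 𝕜 X] [CompleteSpace X]
  [NormedAddCommGroup U] [InnerProductSpace 𝕜 U] [CompleteSpace U] {S : ℝ → X →L[𝕜] X}

theorem integrableOn_control (B : U →L[𝕜] X) {T : ℝ} {u : ℝ → U}
    (hu : MemLp u 2 (volume.restrict (Set.Ioc 0 T))) :
    IntegrableOn (fun t => B (u t)) (Set.Ioc 0 T) :=
  B.integrable_comp (hu.integrable one_le_two)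

/-- The input map `u ↦ ∫₀ᵀ S(T - t) B u(t) dt`. -/
def inputMap (h : JointSemigroup S) (B : U →L[𝕜] X) (T : ℝ) (hT : 0 ≤ T) : Control U T →L[𝕜] X :=
  letI : NormedSpace ℝ X := NormedSpace.restrictScalars ℝ 𝕜 X
  LinearMap.mkContinuousOfExistsBound
    { toFun := fun u => ∫ t in (0 : ℝ)..T, S (T - t) (B (u t))
      map_add' := fun u v => by
        rw [← intervalIntegral.integral_add
          (h.intervalIntegrable_comp hT le_rfl (integrableOn_control B (Lp.memLp u)))
          (h.intervalIntegrable_comp hT le_rfl (integrableOn_control B (Lp.memLp v))),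
          intervalIntegral.integral_of_le hT, intervalIntegral.integral_of_le hT]
        refine integral_congr_ae ?_
        filter_upwards [Lp.coeFn_add u v] with t ht
        rw [ht, Pi.add_apply, _root_.map_add, _root_.map_add]
      map_smul' := fun c u => by
        rw [RingHom.id_apply, ← intervalIntegral.integral_smul,
          intervalIntegral.integral_of_le hT, intervalIntegral.integral_of_le hT]
        refine integral_congr_ae ?_
        filter_upwards [Lp.coeFn_smul c u] with t ht
        rw [ht, Pi.smul_apply, _root_.map_smul, _root_.map_smul] }
    (by
      obtain ⟨M, hM1, hM⟩ := h.isC0Semigroup.exists_bound T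
      refine ⟨M * (‖B‖ * √T), fun u => ?_⟩
      have h1 := norm_mild_le (0 : X) hT (integrableOn_control B (Lp.memLp u)) hM
      have h2 := integral_norm_le_sqrt_mul_eLpNorm hT (Lp.memLp u)
      have h3 : ∫ t in (0 : ℝ)..T, ‖B (u t)‖ ≤ ‖B‖ * ∫ t in (0 : ℝ)..T, ‖u t‖ := by
        rw [← intervalIntegral.integral_const_mul]
        refine intervalIntegral.integral_mono_on hT ?_ ?_ fun t _ => B.le_opNorm _
        · rw [intervalIntegrable_iff_integrableOn_Ioc_of_le hT]
          exact (integrableOn_control B (Lp.memLp u)).norm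
        · rw [intervalIntegrable_iff_integrableOn_Ioc_of_le hT]
          exact ((Lp.memLp u).integrable one_le_two).norm.const_mul _
      rw [sub_zero, ← Lp.norm_def] at h2
      simp only [mild, _root_.map_zero, zero_add, norm_zero, mul_zero] at h1
      refine h1.trans ?_
      rw [mul_assoc, mul_assoc]
      have := h3.trans (mul_le_mul_of_nonneg_left h2 (norm_nonneg B))
      exact mul_le_mul_of_nonneg_left this (by linarith))

theorem endState_eq_add_inputMap (h : JointSemigroup S) (B : U →L[𝕜] X) {T : ℝ} (hT : 0 ≤ T)
    (y₀ : X) (u : Control U T) : endState S B T y₀ u = S T y₀ + inputMap h B T hT u := rfl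

/-- Strong continuity of the adjoint semigroup enters here. Its frozen version is continuous on the
whole line and agrees with it where `T - t ≥ 0`. -/
theorem continuousOn_observation (h : JointSemigroup S) (B : U →L[𝕜] X) (T : ℝ) (ψ : X) :
    ContinuousOn (fun t => (B†) (((S (T - t))†) ψ)) (Set.Icc 0 T) := by
  let _ : NormedSpace ℝ X := NormedSpace.restrictScalars ℝ 𝕜 X
  have hc := h.isC0Semigroup_adjoint.jointSemigroup.continuous_apply ψ
  refine ((B†).continuous.comp (hc.comp (by fun_prop : Continuous fun t : ℝ => T - t))).continuousOn.congr
    fun t ht => ?_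
  simp [max_eq_left (sub_nonneg.2 ht.2)]

theorem memLp_observation (h : JointSemigroup S) (B : U →L[𝕜] X) (T : ℝ) (ψ : X) :
    MemLp (fun t => (B†) (((S (T - t))†) ψ)) 2 (volume.restrict (Set.Ioc 0 T)) := by
  have hc := continuousOn_observation h B T ψ
  obtain ⟨C, hC⟩ := (isCompact_Icc.image_of_continuousOn hc).isBounded.exists_norm_le
  refine MemLp.of_bound ((hc.mono Set.Ioc_subset_Icc_self).aestronglyMeasurable measurableSet_Ioc)
    C ?_
  filter_upwards [ae_restrict_mem measurableSet_Ioc] with t ht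
  exact hC _ ⟨t, Set.Ioc_subset_Icc_self ht, rfl⟩

theorem adjoint_inputMap (h : JointSemigroup S) (B : U →L[𝕜] X) {T : ℝ} (hT : 0 ≤ T) (ψ : X) :
    ((inputMap h B T hT)†) ψ = (memLp_observation h B T ψ).toLp _ := by
  let _ : NormedSpace ℝ X := NormedSpace.restrictScalars ℝ 𝕜 X
  refine ext_inner_left 𝕜 fun u => ?_
  rw [ContinuousLinearMap.adjoint_inner_right, L2.inner_def]
  have e : inputMap h B T hT u = ∫ t in Set.Ioc 0 T, S (T - t) (B (u t)) :=
    intervalIntegral.integral_of_le hT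
  have hI := h.intervalIntegrable_comp hT le_rfl (integrableOn_control B (Lp.memLp u))
  rw [intervalIntegrable_iff_integrableOn_Ioc_of_le hT] at hI
  rw [e, ← inner_conj_symm, ← integral_inner hI, ← integral_conj]
  refine integral_congr_ae ?_
  filter_upwards [(memLp_observation h B T ψ).coeFn_toLp] with t ht
  rw [ht, ContinuousLinearMap.adjoint_inner_right, ContinuousLinearMap.adjoint_inner_right,
    inner_conj_symm]

theorem norm_adjoint_inputMap (h : JointSemigroup S) (B : U →L[𝕜] X) {T : ℝ} (hT : 0 ≤ T) (ψ : X) :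
    ‖((inputMap h B T hT)†) ψ‖ = obsNorm S B T ψ := by
  rw [obsNorm, ← Real.sqrt_sq (norm_nonneg _), adjoint_inputMap,
    ← inner_self_eq_norm_sq (𝕜 := 𝕜), L2.inner_def, intervalIntegral.integral_of_le hT,
    ← integral_re (L2.integrable_inner _ _)]
  congr 1
  refine integral_congr_ae ?_
  filter_upwards [(memLp_observation h B T ψ).coeFn_toLp] with t ht
  rw [ht, inner_self_eq_norm_sq]

/-- The Gramian is `L L†` for the input map `L`, so `⟪G ψ, ψ⟫ = ‖L† ψ‖²`. -/
theorem gramianNorm_eq_obsNorm (h : JointSemigroup S) (B : U →L[𝕜] X) {T : ℝ} (hT : 0 ≤ T) (ψ : X) :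
    gramianNorm S B T ψ = obsNorm S B T ψ := by
  have e : gramian S B T ψ = inputMap h B T hT (((inputMap h B T hT)†) ψ) := by
    rw [adjoint_inputMap]
    let _ : NormedSpace ℝ X := NormedSpace.restrictScalars ℝ 𝕜 X
    change (∫ t in (0 : ℝ)..T, S (T - t) (B ((B†) (((S (T - t))†) ψ)))) =
      ∫ t in (0 : ℝ)..T, S (T - t) (B ((memLp_observation h B T ψ).toLp _ t))
    rw [intervalIntegral.integral_of_le hT, intervalIntegral.integral_of_le hT]
    refine integral_congr_ae ?_
    filter_upwards [(memLp_observation h B T ψ).coeFn_toLp] with t ht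
    rw [ht]
  rw [gramianNorm, e, ← ContinuousLinearMap.adjoint_inner_right, inner_self_eq_norm_sq,
    norm_adjoint_inputMap, Real.sqrt_sq (show 0 ≤ obsNorm S B T ψ from Real.sqrt_nonneg _)]

theorem steersWithCost_iff (h : JointSemigroup S) (B : U →L[𝕜] X) {T α C : ℝ} (hT : 0 ≤ T)
    (hα : 0 ≤ α) (hC : 0 ≤ C) : SteersWithCost S B T α C ↔ WeakObservability S B T α C := by
  have key : ∀ y₀ : X, (∃ u : Control U T, ‖endState S B T y₀ u‖ ≤ α * ‖y₀‖ ∧ ‖u‖ ≤ C * ‖y₀‖) ↔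
      ∀ ψ : X, RCLike.re (inner 𝕜 ψ (S T y₀)) - α * ‖y₀‖ * ‖ψ‖ ≤ C * ‖y₀‖ * obsNorm S B T ψ :=
    fun y₀ => by
      simp only [endState_eq_add_inputMap h B hT, ← norm_adjoint_inputMap h B hT]
      exact exists_norm_add_le_iff _ _ (by positivity) (by positivity)
  simp only [SteersWithCost, key, WeakObservability]
  constructor
  · intro H ψ
    -- The extremal initial state: it turns the left-hand side into `‖S(T)† ψ‖²`, after which one
    -- factor `‖S(T)† ψ‖` cancels.
    have h1 := H (((S T)†) ψ) ψ
    rw [← ContinuousLinearMap.adjoint_inner_left, inner_self_eq_norm_sq] at h1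
    have h0 : 0 ≤ C * obsNorm S B T ψ + α * ‖ψ‖ := by
      have := Real.sqrt_nonneg (∫ t in (0 : ℝ)..T, ‖(B†) (((S (T - t))†) ψ)‖ ^ 2)
      unfold obsNorm
      positivity
    rcases (norm_nonneg (((S T)†) ψ)).eq_or_lt' with h2 | h2
    · rw [h2]; exact h0
    · nlinarith
  · intro H y₀ ψ
    have h1 : RCLike.re (inner 𝕜 ψ (S T y₀)) ≤ ‖((S T)†) ψ‖ * ‖y₀‖ := by
      rw [← ContinuousLinearMap.adjoint_inner_left]
      exact re_inner_le_norm _ _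
    have h2 := mul_le_mul_of_nonneg_right (H ψ) (norm_nonneg y₀)
    linarith

/-- The infimum is attained, because for each fixed `ψ` the condition on the constant is closed. -/
theorem muAt_le_iff {T α : ℝ} {B : U →L[𝕜] X} {y₀ : X} (C : ℝ≥0) :
    muAt S B T α y₀ ≤ C ↔ ∀ ψ : X,
      RCLike.re (inner 𝕜 ψ (S T y₀)) - α * ‖y₀‖ * ‖ψ‖ ≤ (C : ℝ) * gramianNorm S B T ψ := by
  constructor
  · intro H ψ
    refine le_of_forall_pos_le_add fun ε hε => ?_
    have hg : 0 ≤ gramianNorm S B T ψ := Real.sqrt_nonneg _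
    -- The slack is chosen so that `η * gramianNorm S B T ψ ≤ ε`; the `+ 1` avoids a zero
    -- denominator.
    let η : ℝ≥0 := ⟨ε / (gramianNorm S B T ψ + 1), by positivity⟩
    have hη : 0 < η := by
      rw [← NNReal.coe_pos]
      exact div_pos hε (by positivity)
    have h1 : muAt S B T α y₀ < ((C + η : ℝ≥0) : ℝ≥0∞) :=
      H.trans_lt (ENNReal.coe_lt_coe.2 (lt_add_of_pos_right C hη))
    obtain ⟨_, ⟨D, rfl, hD⟩, hlt⟩ := sInf_lt_iff.1 h1
    have h2 : (D : ℝ) ≤ C + ε / (gramianNorm S B T ψ + 1) := by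
      exact_mod_cast (ENNReal.coe_lt_coe.1 hlt).le
    have h3 : ε / (gramianNorm S B T ψ + 1) * gramianNorm S B T ψ ≤ ε := by
      rw [div_mul_eq_mul_div, div_le_iff₀ (by positivity)]
      nlinarith
    nlinarith [hD ψ, mul_le_mul_of_nonneg_right h2 hg]
  · intro H
    exact sInf_le ⟨C, rfl, H⟩

/-- Cauchy–Schwarz in one direction; in the other, the unit vector along `S(T)† ψ` is extremal. If
`S(T)† ψ = 0`, the inequality holds because its right-hand side is nonnegative. -/
theorem mu_le_iff (h : JointSemigroup S) (B : U →L[𝕜] X) {T α : ℝ} (hT : 0 ≤ T) (hα : 0 ≤ α)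
    (C : ℝ≥0) : mu S B T α ≤ C ↔ WeakObservability S B T α C := by
  simp only [mu, iSup_le_iff, muAt_le_iff, gramianNorm_eq_obsNorm h B hT, WeakObservability]
  constructor
  · intro H ψ
    by_cases h0 : ((S T)†) ψ = 0
    · have := Real.sqrt_nonneg (∫ t in (0 : ℝ)..T, ‖(B†) (((S (T - t))†) ψ)‖ ^ 2)
      rw [h0, norm_zero]
      unfold obsNorm
      positivity
    · have hn : ‖((S T)†) ψ‖ ≠ 0 := norm_ne_zero_iff.2 h0
      have h1 : ‖((‖((S T)†) ψ‖⁻¹ : ℝ) : 𝕜) • ((S T)†) ψ‖ = 1 := by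
        rw [norm_smul, RCLike.norm_ofReal, abs_inv, abs_norm, inv_mul_cancel₀ hn]
      have h2 := H _ h1 ψ
      rw [h1, _root_.map_smul, inner_smul_right, ← ContinuousLinearMap.adjoint_inner_left,
        RCLike.re_ofReal_mul, inner_self_eq_norm_sq, sq, inv_mul_cancel_left₀ hn] at h2
      linarith
  · intro H y₀ hy₀ ψ
    have h1 : RCLike.re (inner 𝕜 ψ (S T y₀)) ≤ ‖((S T)†) ψ‖ * ‖y₀‖ := by
      rw [← ContinuousLinearMap.adjoint_inner_left]
      exact re_inner_le_norm _ _
    rw [hy₀] at h1 ⊢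
    linarith [H ψ]

theorem mu_lt_top_iff (h : JointSemigroup S) (B : U →L[𝕜] X) {T α : ℝ} (hT : 0 ≤ T) (hα : 0 ≤ α) :
    mu S B T α < ⊤ ↔ ∃ C : ℝ, 0 < C ∧ WeakObservability S B T α C := by
  constructor
  · intro H
    lift mu S B T α to ℝ≥0 using H.ne with m hm
    -- The constant must be strictly positive, whereas `m` may be `0`.
    have h1 : mu S B T α ≤ ((m + 1 : ℝ≥0) : ℝ≥0∞) := by
      rw [← hm]
      exact ENNReal.coe_le_coe.2 (by simp)
    exact ⟨_, by positivity, (mu_le_iff h B hT hα _).1 h1⟩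
  · rintro ⟨C, hC, H⟩
    lift C to ℝ≥0 using hC.le
    exact ((mu_le_iff h B hT hα C).2 H).trans_lt ENNReal.coe_lt_top

theorem isLeast_weakObservability (h : JointSemigroup S) (B : U →L[𝕜] X) {T α : ℝ} (hT : 0 ≤ T)
    (hα : 0 ≤ α) (H : mu S B T α < ⊤) :
    IsLeast {C : ℝ | 0 ≤ C ∧ WeakObservability S B T α C} (mu S B T α).toReal := by
  refine ⟨⟨ENNReal.toReal_nonneg, ?_⟩, fun C hC => ?_⟩
  · refine (mu_le_iff h B hT hα (mu S B T α).toNNReal).1 ?_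
    rw [ENNReal.coe_toNNReal H.ne]
  · obtain ⟨hC0, hC⟩ := hC
    lift C to ℝ≥0 using hC0
    exact ENNReal.toReal_mono ENNReal.coe_ne_top ((mu_le_iff h B hT hα C).2 hC)

end InputMap

/-! ### Square integrable state-control pairs and the pairs of minimal norm. -/

section Trajectory

variable {𝕜 X U : Type*} [RCLike 𝕜]
  [NormedAddCommGroup X] [InnerProductSpace 𝕜 X] [CompleteSpace X] [NormedSpace ℝ X]
  [NormedAddCommGroup U] [InnerProductSpace 𝕜 U] [CompleteSpace U] [NormedSpace ℝ U]
  {S : ℝ → X →L[𝕜] X}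

/-- The space `L²(0,∞; X × U)` of pairs of a state and a control. -/
abbrev PairSpace (X U : Type*) [NormedAddCommGroup X] [NormedAddCommGroup U] : Type _ :=
  Lp (WithLp 2 (X × U)) 2 (volume.restrict (Set.Ioi (0 : ℝ)))

/-- The forcing term `B u` of a state-control pair `(y, u)`. -/
def forcing (B : U →L[𝕜] X) (f : ℝ → WithLp 2 (X × U)) (t : ℝ) : X := B (f t).snd

/-- The state of the pair `f` is the mild solution starting from `x` for the control of `f`. -/
def IsTrajectory (S : ℝ → X →L[𝕜] X) (B : U →L[𝕜] X) (x : X) (f : ℝ → WithLp 2 (X × U)) : Prop :=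
  ∀ᵐ t ∂(volume.restrict (Set.Ioi (0 : ℝ))), (f t).fst = mild S x (forcing B f) t

theorem memLp_snd {f : ℝ → WithLp 2 (X × U)} {μ : Measure ℝ} (hf : MemLp f 2 μ) :
    MemLp (fun t => (f t).snd) 2 μ :=
  (WithLp.sndL 2 ℝ X U).comp_memLp' hf

theorem restrict_Ioc_le (t : ℝ) :
    volume.restrict (Set.Ioc 0 t) ≤ volume.restrict (Set.Ioi (0 : ℝ)) :=
  Measure.restrict_mono Set.Ioc_subset_Ioi_self le_rfl

theorem integrableOn_forcing (B : U →L[𝕜] X) {f : ℝ → WithLp 2 (X × U)}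
    (hf : MemLp f 2 (volume.restrict (Set.Ioi 0))) (t : ℝ) :
    IntegrableOn (forcing B f) (Set.Ioc 0 t) :=
  integrableOn_control B ((memLp_snd hf).mono_measure (restrict_Ioc_le t))

theorem mild_congr {x : X} {g g' : ℝ → X} {t : ℝ} (ht : 0 ≤ t)
    (hg : g =ᵐ[volume.restrict (Set.Ioc 0 t)] g') : mild S x g t = mild S x g' t := by
  rw [mild, mild, intervalIntegral.integral_of_le ht, intervalIntegral.integral_of_le ht]
  congr 1
  refine integral_congr_ae ?_
  filter_upwards [hg] with s hs
  rw [hs]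

theorem forcing_congr (B : U →L[𝕜] X) {f f' : ℝ → WithLp 2 (X × U)}
    (hf : f =ᵐ[volume.restrict (Set.Ioi 0)] f') (t : ℝ) :
    forcing B f =ᵐ[volume.restrict (Set.Ioc 0 t)] forcing B f' := by
  filter_upwards [ae_mono (restrict_Ioc_le t) hf] with s hs
  rw [forcing, hs, forcing]

theorem IsTrajectory.congr {B : U →L[𝕜] X} {x : X} {f f' : ℝ → WithLp 2 (X × U)}
    (h : IsTrajectory S B x f) (hf : f =ᵐ[volume.restrict (Set.Ioi 0)] f') :
    IsTrajectory S B x f' := by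
  filter_upwards [h, hf, ae_restrict_mem measurableSet_Ioi] with t h1 h2 ht
  rw [← h2, h1]
  exact mild_congr (le_of_lt ht) (forcing_congr B hf t)

/-- The state at time `t` reached from `0` under the control of a pair. -/
def forcedState (h : JointSemigroup S) (B : U →L[𝕜] X) (t : ℝ) (ht : 0 ≤ t) :
    PairSpace X U →L[𝕜] X :=
  LinearMap.mkContinuousOfExistsBound
    { toFun := fun f => mild S 0 (forcing B f) t
      map_add' := fun f g => by
        rw [mild, mild, mild, _root_.map_zero, zero_add, zero_add, zero_add,
          ← intervalIntegral.integral_add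
          (h.intervalIntegrable_comp ht le_rfl (integrableOn_forcing B (Lp.memLp f) t))
          (h.intervalIntegrable_comp ht le_rfl (integrableOn_forcing B (Lp.memLp g) t)),
          intervalIntegral.integral_of_le ht, intervalIntegral.integral_of_le ht]
        refine integral_congr_ae ?_
        filter_upwards [ae_mono (restrict_Ioc_le t) (Lp.coeFn_add f g)] with s hs
        rw [forcing, hs, Pi.add_apply, WithLp.add_snd, _root_.map_add, _root_.map_add]
        rfl
      map_smul' := fun c f => by
        rw [RingHom.id_apply, mild, mild, _root_.map_zero, zero_add, zero_add,
          ← intervalIntegral.integral_smul,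
          intervalIntegral.integral_of_le ht, intervalIntegral.integral_of_le ht]
        refine integral_congr_ae ?_
        filter_upwards [ae_mono (restrict_Ioc_le t) (Lp.coeFn_smul c f)] with s hs
        rw [forcing, hs, Pi.smul_apply, WithLp.smul_snd, _root_.map_smul, _root_.map_smul]
        rfl }
    (by
      obtain ⟨M, hM1, hM⟩ := h.isC0Semigroup.exists_bound t
      refine ⟨M * (‖B‖ * √t), fun f => ?_⟩
      have hf := (memLp_snd (Lp.memLp f)).mono_measure (restrict_Ioc_le t)
      have h1 := norm_mild_le (0 : X) ht (integrableOn_forcing B (Lp.memLp f) t) hM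
      have h2 := integral_norm_le_sqrt_mul_eLpNorm ht hf
      have h3 : ∫ s in (0 : ℝ)..t, ‖forcing B f s‖ ≤ ‖B‖ * ∫ s in (0 : ℝ)..t, ‖(f s).snd‖ := by
        rw [← intervalIntegral.integral_const_mul]
        refine intervalIntegral.integral_mono_on ht ?_ ?_ fun s _ => B.le_opNorm _
        · rw [intervalIntegrable_iff_integrableOn_Ioc_of_le ht]
          exact (integrableOn_forcing B (Lp.memLp f) t).norm
        · rw [intervalIntegrable_iff_integrableOn_Ioc_of_le ht]
          exact (hf.integrable one_le_two).norm.const_mul _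
      have h4 : (eLpNorm (fun s => (f s).snd) 2 (volume.restrict (Set.Ioc 0 t))).toReal ≤ ‖f‖ := by
        rw [Lp.norm_def]
        refine ENNReal.toReal_mono (Lp.memLp f).2.ne ?_
        exact (eLpNorm_mono_measure _ (restrict_Ioc_le t)).trans
          (eLpNorm_mono fun s => WithLp.norm_snd_le _ _)
      rw [sub_zero] at h2
      rw [norm_zero, mul_zero, zero_add] at h1
      refine h1.trans ?_
      rw [mul_assoc, mul_assoc]
      have h5 := h3.trans (mul_le_mul_of_nonneg_left
        (h2.trans (mul_le_mul_of_nonneg_left h4 (Real.sqrt_nonneg t))) (norm_nonneg B))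
      exact mul_le_mul_of_nonneg_left h5 (by linarith))

theorem mild_forcing (h : JointSemigroup S) (B : U →L[𝕜] X) {t : ℝ} (ht : 0 ≤ t) (x : X)
    (f : PairSpace X U) : mild S x (forcing B f) t = S t x + forcedState h B t ht f := by
  change _ = S t x + mild S 0 (forcing B f) t
  rw [mild, mild, _root_.map_zero, zero_add]

theorem IsTrajectory.add {B : U →L[𝕜] X} {x x' : X} {f f' : PairSpace X U} (h : JointSemigroup S)
    (hf : IsTrajectory S B x f) (hf' : IsTrajectory S B x' f') :
    IsTrajectory S B (x + x') (f + f' : PairSpace X U) := by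
  filter_upwards [hf, hf', Lp.coeFn_add f f', ae_restrict_mem measurableSet_Ioi] with t h1 h2 h3 ht
  rw [mild_forcing h B (le_of_lt ht)] at h1 h2 ⊢
  rw [h3, Pi.add_apply, WithLp.add_fst, h1, h2, _root_.map_add, _root_.map_add]
  abel

theorem IsTrajectory.smul {B : U →L[𝕜] X} {x : X} {f : PairSpace X U} (h : JointSemigroup S)
    (hf : IsTrajectory S B x f) (c : 𝕜) :
    IsTrajectory S B (c • x) (c • f : PairSpace X U) := by
  filter_upwards [hf, Lp.coeFn_smul c f, ae_restrict_mem measurableSet_Ioi] with t h1 h3 ht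
  rw [mild_forcing h B (le_of_lt ht)] at h1 ⊢
  rw [h3, Pi.smul_apply, WithLp.smul_fst, h1, _root_.map_smul, _root_.map_smul, smul_add]

theorem isTrajectory_zero (h : JointSemigroup S) (B : U →L[𝕜] X) :
    IsTrajectory S B 0 (0 : PairSpace X U) := by
  filter_upwards [Lp.coeFn_zero (WithLp 2 (X × U)) 2 (volume.restrict (Set.Ioi (0 : ℝ))),
    ae_restrict_mem measurableSet_Ioi] with t h1 ht
  rw [mild_forcing h B (le_of_lt ht), h1, _root_.map_zero, _root_.map_zero]
  simp

/-- The square integrable pairs starting from the state `0`. -/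
def nullPairs (h : JointSemigroup S) (B : U →L[𝕜] X) : Submodule 𝕜 (PairSpace X U) where
  carrier := {f | IsTrajectory S B 0 f}
  zero_mem' := isTrajectory_zero h B
  add_mem' {f g} hf hg := by simpa using IsTrajectory.add h hf hg
  smul_mem' c f hf := by simpa using IsTrajectory.smul h hf c

theorem mem_nullPairs {h : JointSemigroup S} {B : U →L[𝕜] X} {f : PairSpace X U} :
    f ∈ nullPairs h B ↔ IsTrajectory S B 0 f := Iff.rfl

/-- Along a subsequence the states converge almost everywhere, while at each time the state produced
by the control is a continuous function of the pair in `L²`. -/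
theorem isClosed_nullPairs (h : JointSemigroup S) (B : U →L[𝕜] X) :
    IsClosed (nullPairs h B : Set (PairSpace X U)) := by
  refine IsSeqClosed.isClosed fun f f₀ hf hlim => ?_
  obtain ⟨ns, hns, hae⟩ := (tendstoInMeasure_of_tendsto_Lp hlim).exists_seq_tendsto_ae
  have hall : ∀ᵐ t ∂(volume.restrict (Set.Ioi (0 : ℝ))), ∀ n,
      (f n t).fst = mild S 0 (forcing B (f n)) t := ae_all_iff.2 fun n => hf n
  change IsTrajectory S B 0 f₀
  filter_upwards [hae, hall, ae_restrict_mem measurableSet_Ioi] with t h1 h2 ht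
  have ht : 0 ≤ t := le_of_lt ht
  have h3 : Tendsto (fun n => (f (ns n) t).fst) atTop (𝓝 (f₀ t).fst) :=
    ((WithLp.fstL 2 𝕜 X U).continuous.tendsto _).comp h1
  refine tendsto_nhds_unique h3 ?_
  simp only [h2]
  exact (((forcedState h B t ht).continuous.tendsto f₀).comp hlim).comp hns.tendsto_atTop

theorem eq_of_isTrajectory_of_mem_orthogonal {h : JointSemigroup S} {B : U →L[𝕜] X} {x : X}
    {f g : PairSpace X U} (hf : IsTrajectory S B x f) (hg : IsTrajectory S B x g)
    (hf' : f ∈ (nullPairs h B)ᗮ) (hg' : g ∈ (nullPairs h B)ᗮ) : f = g := by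
  have h3 : f - g ∈ nullPairs h B := by
    have := IsTrajectory.add h hf (IsTrajectory.smul h hg (-1))
    rw [mem_nullPairs]
    simpa [sub_eq_add_neg] using this
  have h4 : f - g ∈ (nullPairs h B)ᗮ := Submodule.sub_mem _ hf' hg'
  exact sub_eq_zero.1 (inner_self_eq_zero (𝕜 := 𝕜) |>.1 (h4 _ h3))

/-- If every state is the start of a square integrable pair of norm controlled by that of the state,
the pairs of minimal norm depend linearly and continuously on the state. -/
theorem exists_optimalPair (h : JointSemigroup S) (B : U →L[𝕜] X) {C : ℝ}
    (H : ∀ x : X, ∃ f : PairSpace X U, IsTrajectory S B x f ∧ ‖f‖ ≤ C * ‖x‖) :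
    ∃ Φ : X →L[𝕜] PairSpace X U, ∀ x, IsTrajectory S B x (Φ x) ∧ Φ x ∈ (nullPairs h B)ᗮ := by
  have : CompleteSpace (nullPairs h B) := (isClosed_nullPairs h B).completeSpace_coe
  have hex : ∀ x : X, ∃ f : PairSpace X U, (IsTrajectory S B x f ∧ f ∈ (nullPairs h B)ᗮ) ∧
      ‖f‖ ≤ C * ‖x‖ := fun x => by
    obtain ⟨g, hg, hgC⟩ := H x
    -- Removing the component in `nullPairs` keeps the initial state and does not increase the norm.
    obtain ⟨a, ha, f, hf, rfl⟩ := (nullPairs h B).exists_add_mem_mem_orthogonal g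
    refine ⟨f, ⟨?_, hf⟩, ?_⟩
    · have := IsTrajectory.add h hg (((nullPairs h B).neg_mem ha) : IsTrajectory S B 0 _)
      simpa using this
    · refine le_trans ?_ hgC
      have := norm_add_sq_eq_norm_sq_add_norm_sq_of_inner_eq_zero a f (hf a ha)
      nlinarith [norm_nonneg f, norm_nonneg (a + f), mul_self_nonneg ‖a‖]
  choose Φ hΦ hC using hex
  -- Uniqueness of the orthogonal representative makes the chosen map additive and homogeneous.
  have huniq : ∀ (x : X) (f : PairSpace X U), IsTrajectory S B x f → f ∈ (nullPairs h B)ᗮ →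
      f = Φ x := fun x f h1 h2 =>
    eq_of_isTrajectory_of_mem_orthogonal h1 (hΦ x).1 h2 (hΦ x).2
  refine ⟨LinearMap.mkContinuousOfExistsBound
    { toFun := Φ
      map_add' := fun x y => (huniq _ _ (IsTrajectory.add h (hΦ x).1 (hΦ y).1)
        (Submodule.add_mem _ (hΦ x).2 (hΦ y).2)).symm
      map_smul' := fun c x => (huniq _ _ (IsTrajectory.smul h (hΦ x).1 c)
        (Submodule.smul_mem _ c (hΦ x).2)).symm } ⟨C, hC⟩, hΦ⟩

theorem measurePreserving_add_right_Ioi (τ : ℝ) :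
    MeasurePreserving (fun t : ℝ => t + τ) (volume.restrict (Set.Ioi 0))
      (volume.restrict (Set.Ioi τ)) := by
  have := (measurePreserving_add_right (volume : Measure ℝ) τ).restrict_preimage
    (measurableSet_Ioi (a := τ))
  simpa using this

theorem measurePreserving_sub_right_Ioi (τ : ℝ) :
    MeasurePreserving (fun t : ℝ => t - τ) (volume.restrict (Set.Ioi τ))
      (volume.restrict (Set.Ioi 0)) := by
  have := (measurePreserving_sub_right (volume : Measure ℝ) τ).restrict_preimage
    (measurableSet_Ioi (a := 0))
  simpa using this

theorem MemLp.shift {E : Type*} [NormedAddCommGroup E] {f : ℝ → E}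
    (hf : MemLp f 2 (volume.restrict (Set.Ioi 0))) {τ : ℝ} (hτ : 0 ≤ τ) :
    MemLp (fun t => f (t + τ)) 2 (volume.restrict (Set.Ioi 0)) :=
  MemLp.comp_measurePreserving (hf.mono_measure (Measure.restrict_mono (Set.Ioi_subset_Ioi hτ) le_rfl))
    (measurePreserving_add_right_Ioi τ)

theorem IsTrajectory.shift {B : U →L[𝕜] X} {x : X} {f : ℝ → WithLp 2 (X × U)}
    (h : JointSemigroup S) (hf : IsTrajectory S B x f)
    (hfL : MemLp f 2 (volume.restrict (Set.Ioi 0))) {τ : ℝ} (hτ : 0 ≤ τ) :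
    IsTrajectory S B (mild S x (forcing B f) τ) (fun t => f (t + τ)) := by
  have h1 : ∀ᵐ t ∂(volume.restrict (Set.Ioi τ)), (f t).fst = mild S x (forcing B f) t :=
    ae_mono (Measure.restrict_mono (Set.Ioi_subset_Ioi hτ) le_rfl) hf
  have h2 := (measurePreserving_add_right_Ioi τ).quasiMeasurePreserving.ae h1
  filter_upwards [h2, ae_restrict_mem measurableSet_Ioi] with t ht ht0
  rw [ht, h.mild_add_time x hτ (le_of_lt ht0) (integrableOn_forcing B hfL _)]
  rfl

/-- Apply the constant control `w` from the state `0` during `(0, τ]`, then follow `a`. -/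
def prependConst (S : ℝ → X →L[𝕜] X) (B : U →L[𝕜] X) (w : U) (τ : ℝ) (a : ℝ → WithLp 2 (X × U)) :
    ℝ → WithLp 2 (X × U) :=
  (Set.Iic τ).piecewise (fun t => WithLp.toLp 2 (mild S 0 (fun _ => B w) t, w)) (fun t => a (t - τ))

theorem continuousOn_mild_const (h : JointSemigroup S) (y : X) (τ : ℝ) :
    ContinuousOn (mild S 0 (fun _ => y)) (Set.Icc 0 τ) :=
  h.continuousOn_mild 0 (integrableOn_const (by simp))

theorem memLp_prependConst (h : JointSemigroup S) (B : U →L[𝕜] X) (w : U) (τ : ℝ)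
    {a : ℝ → WithLp 2 (X × U)} (ha : MemLp a 2 (volume.restrict (Set.Ioi 0))) (hτ : 0 ≤ τ) :
    MemLp (prependConst S B w τ a) 2 (volume.restrict (Set.Ioi 0)) := by
  refine MemLp.piecewise measurableSet_Iic ?_ ?_
  · rw [Measure.restrict_restrict measurableSet_Iic, Set.inter_comm, Set.Ioi_inter_Iic]
    have hc : ContinuousOn (fun t => WithLp.toLp 2 (mild S 0 (fun _ => B w) t, w)) (Set.Icc 0 τ) :=
      (WithLp.prod_continuous_toLp 2 X U).comp_continuousOn
        ((continuousOn_mild_const h (B w) τ).prodMk continuousOn_const)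
    obtain ⟨C, hC⟩ := (isCompact_Icc.image_of_continuousOn hc).isBounded.exists_norm_le
    refine MemLp.of_bound ((hc.mono Set.Ioc_subset_Icc_self).aestronglyMeasurable measurableSet_Ioc)
      C ?_
    filter_upwards [ae_restrict_mem measurableSet_Ioc] with t ht
    exact hC _ ⟨t, Set.Ioc_subset_Icc_self ht, rfl⟩
  · rw [Measure.restrict_restrict measurableSet_Iic.compl, Set.compl_Iic,
      Set.inter_eq_left.2 (Set.Ioi_subset_Ioi hτ)]
    exact MemLp.comp_measurePreserving ha (measurePreserving_sub_right_Ioi τ)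

theorem prependConst_of_le {B : U →L[𝕜] X} {w : U} {τ t : ℝ} {a : ℝ → WithLp 2 (X × U)}
    (ht : t ≤ τ) : prependConst S B w τ a t = WithLp.toLp 2 (mild S 0 (fun _ => B w) t, w) :=
  Set.piecewise_eq_of_mem _ _ _ ht

theorem prependConst_of_lt {B : U →L[𝕜] X} {w : U} {τ t : ℝ} {a : ℝ → WithLp 2 (X × U)}
    (ht : τ < t) : prependConst S B w τ a t = a (t - τ) :=
  Set.piecewise_eq_of_notMem _ _ _ (not_le.2 ht)

/-- These pairs are the competitors for the first variation: `a` takes over at the state to which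
the constant control has led. -/
theorem IsTrajectory.prependConst {B : U →L[𝕜] X} {w : U} {τ : ℝ} (h : JointSemigroup S)
    (hτ : 0 ≤ τ) {a : ℝ → WithLp 2 (X × U)}
    (haL : MemLp a 2 (volume.restrict (Set.Ioi 0)))
    (ha : IsTrajectory S B (mild S 0 (fun _ => B w) τ) a) :
    IsTrajectory S B 0 (prependConst S B w τ a) := by
  have h2 := (ae_restrict_iff' measurableSet_Ioi).1 ((measurePreserving_sub_right_Ioi τ).quasiMeasurePreserving.ae ha)
  have hle : ∀ t, 0 ≤ t → t ≤ τ →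
      mild S 0 (forcing B (ControlSystem.prependConst S B w τ a)) t = mild S 0 (fun _ => B w) t :=
    fun t h0 ht => by
      refine mild_congr h0 ?_
      filter_upwards [ae_restrict_mem measurableSet_Ioc] with s hs
      rw [forcing, prependConst_of_le (hs.2.trans ht), WithLp.toLp_snd]
  rw [IsTrajectory, ae_restrict_iff' measurableSet_Ioi]
  filter_upwards [h2] with t ht ht0
  rcases le_or_gt t τ with htτ | htτ
  · rw [hle t (le_of_lt ht0) htτ, prependConst_of_le htτ, WithLp.toLp_fst]
  · have h3 := h.mild_add_time (s := τ) (t := t - τ) 0 hτ (by linarith)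
      (integrableOn_forcing B (memLp_prependConst h B w τ haL hτ) _)
    rw [sub_add_cancel, hle τ hτ le_rfl] at h3
    rw [prependConst_of_lt htτ, ht htτ, h3]
    refine mild_congr (by linarith) ?_
    filter_upwards [ae_restrict_mem measurableSet_Ioc] with s hs
    rw [forcing, forcing, prependConst_of_lt (by linarith [hs.1]), add_sub_cancel_right]

/-- The first variation of the norm at a pair orthogonal to `nullPairs`. -/
theorem first_variation {h : JointSemigroup S} {B : U →L[𝕜] X} {f : PairSpace X U}
    (hf : f ∈ (nullPairs h B)ᗮ) {w : U} {τ : ℝ} (hτ : 0 ≤ τ) {a : PairSpace X U}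
    (ha : IsTrajectory S B (mild S 0 (fun _ => B w) τ) a) :
    (∫ t in (0 : ℝ)..τ, (inner 𝕜 (mild S 0 (fun _ => B w) t) (f t).fst + inner 𝕜 w (f t).snd)) +
      ∫ t in Set.Ioi (0 : ℝ), inner 𝕜 (a t) (f (t + τ)) = 0 := by
  have hL := memLp_prependConst h B w τ (Lp.memLp a) hτ
  have hmem : hL.toLp _ ∈ nullPairs h B :=
    (IsTrajectory.prependConst h hτ (Lp.memLp a) ha).congr hL.coeFn_toLp.symm
  have h0 := hf _ hmem
  rw [L2.inner_def] at h0
  have hI := L2.integrable_inner (𝕜 := 𝕜) (hL.toLp _) f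
  have e1 : ∀ᵐ t ∂(volume.restrict (Set.Ioi (0 : ℝ))), inner 𝕜 (hL.toLp _ t) (f t) =
      inner 𝕜 (prependConst S B w τ a t) (f t) := by
    filter_upwards [hL.coeFn_toLp] with t ht
    rw [ht]
  rw [integral_congr_ae e1] at h0
  have hI' : IntegrableOn (fun t => inner 𝕜 (prependConst S B w τ a t) (f t)) (Set.Ioi 0) :=
    hI.congr e1
  have hsplit := setIntegral_union (Set.Ioc_disjoint_Ioi (le_refl τ))
    measurableSet_Ioi (hI'.mono_set (show Set.Ioc 0 τ ⊆ Set.Ioi 0 from Set.Ioc_subset_Ioi_self))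
    (hI'.mono_set (Set.Ioi_subset_Ioi hτ))
  rw [Set.Ioc_union_Ioi_eq_Ioi hτ, h0] at hsplit
  refine Eq.trans ?_ hsplit.symm
  rw [intervalIntegral.integral_of_le hτ]
  congr 1
  · refine setIntegral_congr_fun measurableSet_Ioc fun t ht => ?_
    simp only [prependConst_of_le ht.2, WithLp.prod_inner_apply]
    rfl
  · rw [← (measurePreserving_add_right_Ioi τ).integral_comp (measurableEmbedding_addRight τ)]
    refine setIntegral_congr_fun measurableSet_Ioi fun t ht => ?_
    simp only [prependConst_of_lt (lt_add_of_pos_left τ ht), add_sub_cancel_right]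

end Trajectory

/-! ### The optimal flow is a bounded semigroup driven by a bounded feedback. -/

section OptimalFlow

variable {𝕜 X U : Type*} [RCLike 𝕜]
  [NormedAddCommGroup X] [InnerProductSpace 𝕜 X] [CompleteSpace X] [NormedSpace ℝ X]
  [NormedAddCommGroup U] [InnerProductSpace 𝕜 U] [CompleteSpace U] [NormedSpace ℝ U]
  {S : ℝ → X →L[𝕜] X}

/-- The state at time `t` along the pair assigned by `Φ` to the initial state. -/
def optimalFlow (h : JointSemigroup S) (B : U →L[𝕜] X) (Φ : X →L[𝕜] PairSpace X U) (t : ℝ) :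
    X →L[𝕜] X :=
  S (max t 0) + (forcedState h B (max t 0) (le_max_right _ _)).comp Φ

theorem optimalFlow_max (h : JointSemigroup S) (B : U →L[𝕜] X) (Φ : X →L[𝕜] PairSpace X U) (t : ℝ) :
    optimalFlow h B Φ (max t 0) = optimalFlow h B Φ t := by
  simp only [optimalFlow, max_eq_left (le_max_right t 0)]

theorem optimalFlow_apply (h : JointSemigroup S) (B : U →L[𝕜] X) (Φ : X →L[𝕜] PairSpace X U)
    {t : ℝ} (ht : 0 ≤ t) (x : X) :
    optimalFlow h B Φ t x = mild S x (forcing B (Φ x)) t := by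
  rw [mild_forcing h B ht]
  simp only [optimalFlow, max_eq_left ht]
  rfl

variable {h : JointSemigroup S} {B : U →L[𝕜] X} {Φ : X →L[𝕜] PairSpace X U}

theorem ae_fst_eq_optimalFlow (hΦ : ∀ x, IsTrajectory S B x (Φ x) ∧ Φ x ∈ (nullPairs h B)ᗮ) (x : X) :
    ∀ᵐ t ∂(volume.restrict (Set.Ioi (0 : ℝ))), (Φ x t).fst = optimalFlow h B Φ t x := by
  filter_upwards [(hΦ x).1, ae_restrict_mem measurableSet_Ioi] with t h1 ht
  rw [h1, optimalFlow_apply h B Φ (le_of_lt ht)]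

/-- Bellman's principle: the tail of an optimal pair is optimal. -/
theorem ae_optimalFlow_shift (hΦ : ∀ x, IsTrajectory S B x (Φ x) ∧ Φ x ∈ (nullPairs h B)ᗮ) (x : X)
    {τ : ℝ} (hτ : 0 ≤ τ) :
    Φ (optimalFlow h B Φ τ x) =ᵐ[volume.restrict (Set.Ioi 0)] fun t => Φ x (t + τ) := by
  have hL := MemLp.shift (Lp.memLp (Φ x)) hτ
  have hT : IsTrajectory S B (optimalFlow h B Φ τ x) (hL.toLp _) := by
    rw [optimalFlow_apply h B Φ hτ]
    exact ((hΦ x).1.shift h (Lp.memLp (Φ x)) hτ).congr hL.coeFn_toLp.symm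
  have hO : hL.toLp _ ∈ (nullPairs h B)ᗮ := by
    intro a ha
    -- With zero control the state stays at `0` until `τ`, so any null pair may be delayed by `τ`;
    -- the first variation then reduces to orthogonality of the tail.
    have ha' : IsTrajectory S B (mild S 0 (fun _ => B (0 : U)) τ) a := by
      simpa [mild] using mem_nullPairs.1 ha
    have := first_variation (hΦ x).2 hτ ha'
    simp only [mild, _root_.map_zero, intervalIntegral.integral_zero, add_zero, inner_zero_left,
      zero_add] at this
    rw [L2.inner_def, ← this]
    refine integral_congr_ae ?_
    filter_upwards [hL.coeFn_toLp] with t ht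
    rw [ht]
  rw [eq_of_isTrajectory_of_mem_orthogonal (hΦ _).1 hT (hΦ _).2 hO]
  exact hL.coeFn_toLp

/-- The semigroup law is Bellman's principle combined with restarting the mild solution at an
intermediate time. -/
theorem jointSemigroup_optimalFlow
    (hΦ : ∀ x, IsTrajectory S B x (Φ x) ∧ Φ x ∈ (nullPairs h B)ᗮ) :
    JointSemigroup (optimalFlow h B Φ) := by
  have hzero : optimalFlow h B Φ 0 = ContinuousLinearMap.id 𝕜 X := by
    ext x
    rw [optimalFlow_apply h B Φ le_rfl, mild, intervalIntegral.integral_same, add_zero, h.map_zero]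
  have hc : IsC0Semigroup (optimalFlow h B Φ) :=
    { map_zero := hzero
      map_add := fun s t hs ht => by
        ext x
        rw [ContinuousLinearMap.comp_apply, optimalFlow_apply h B Φ (add_nonneg hs ht),
          h.mild_add_time x ht hs (integrableOn_forcing B (Lp.memLp _) _), optimalFlow_apply h B Φ hs,
          ← optimalFlow_apply h B Φ ht]
        refine mild_congr hs ?_
        exact (forcing_congr B (ae_optimalFlow_shift hΦ x ht) s).symm
      tendsto_zero := fun x => by
        have h1 := h.continuousOn_mild x (integrableOn_forcing B (Lp.memLp (Φ x)) 1) 0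
          ⟨le_rfl, zero_le_one⟩
        have h2 := h1.mono_left (nhdsWithin_le_iff.2 (Icc_mem_nhdsGT zero_lt_one))
        rw [← optimalFlow_apply h B Φ le_rfl, hzero] at h2
        refine h2.congr' ?_
        filter_upwards [self_mem_nhdsWithin] with t ht
        rw [optimalFlow_apply h B Φ (le_of_lt ht)] }
  -- `optimalFlow` is already frozen at negative times, so the frozen semigroup is the flow itself.
  have := hc.jointSemigroup
  simpa only [optimalFlow_max] using this

/-- For `r` in the unit window before `t`, the state at `t` is at most `M` times the state at `r`.
Integrating the squares over the window bounds it by `M` times the `L²` norm of the whole pair,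
which is at most `‖Φ‖ ‖x‖`. -/
theorem exists_bound_optimalFlow
    (hΦ : ∀ x, IsTrajectory S B x (Φ x) ∧ Φ x ∈ (nullPairs h B)ᗮ) :
    ∃ M : ℝ, 1 ≤ M ∧ ∀ t, 0 ≤ t → ‖optimalFlow h B Φ t‖ ≤ M := by
  have hT := jointSemigroup_optimalFlow hΦ
  obtain ⟨M, hM1, hM⟩ := hT.isC0Semigroup.exists_bound 1
  refine ⟨max M (M * ‖Φ‖), hM1.trans (le_max_left _ _), fun t ht => ?_⟩
  rcases le_total t 1 with ht1 | ht1
  · exact (hM t ht ht1).trans (le_max_left _ _)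
  refine le_trans ?_ (le_max_right _ _)
  refine ContinuousLinearMap.opNorm_le_bound _ (by positivity) fun x => ?_
  have hI : Integrable (fun r => ‖Φ x r‖ ^ 2) (volume.restrict (Set.Ioi (0 : ℝ))) :=
    (Lp.memLp (Φ x)).integrable_norm_pow two_ne_zero
  have hsub : volume.restrict (Set.Ioc (t - 1) t) ≤ volume.restrict (Set.Ioi (0 : ℝ)) :=
    Measure.restrict_mono (Set.Ioc_subset_Ioi_self.trans (Set.Ioi_subset_Ioi (by linarith))) le_rfl
  have hnorm : ∫ r in Set.Ioi (0 : ℝ), ‖Φ x r‖ ^ 2 = ‖Φ x‖ ^ 2 := by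
    rw [← inner_self_eq_norm_sq (𝕜 := 𝕜) (Φ x), L2.inner_def,
      ← integral_re (L2.integrable_inner _ _)]
    simp only [inner_self_eq_norm_sq]
  have h1 : ∫ _ in Set.Ioc (t - 1) t, ‖optimalFlow h B Φ t x‖ ^ 2 ≤
      ∫ r in Set.Ioc (t - 1) t, M ^ 2 * ‖Φ x r‖ ^ 2 := by
    refine integral_mono_ae (integrable_const _) ((hI.mono_measure hsub).const_mul _) ?_
    filter_upwards [ae_mono hsub (ae_fst_eq_optimalFlow hΦ x), ae_restrict_mem measurableSet_Ioc]
      with r hr hrt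
    have e := hT.map_add_apply (s := t - r) (t := r) (by linarith [hrt.2]) (by linarith [hrt.1]) x
    rw [sub_add_cancel] at e
    have h2 : ‖optimalFlow h B Φ t x‖ ≤ M * ‖Φ x r‖ := by
      rw [e, ← hr]
      refine ((optimalFlow h B Φ (t - r)).le_of_opNorm_le
        (hM _ (by linarith [hrt.2]) (by linarith [hrt.1])) _).trans ?_
      gcongr
      exact WithLp.norm_fst_le _ _
    rw [← mul_pow]
    exact pow_le_pow_left₀ (norm_nonneg _) h2 2
  have h3 : ∫ r in Set.Ioc (t - 1) t, ‖Φ x r‖ ^ 2 ≤ ‖Φ x‖ ^ 2 := by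
    rw [← hnorm]
    exact integral_mono_measure hsub (Eventually.of_forall fun _ => by positivity) hI
  rw [integral_const_mul, setIntegral_const, Measure.real, Real.volume_Ioc, sub_sub_cancel,
    ENNReal.ofReal_one, ENNReal.toReal_one, one_smul] at h1
  have h4 : ‖optimalFlow h B Φ t x‖ ^ 2 ≤ (M * ‖Φ x‖) ^ 2 := by
    rw [mul_pow]
    exact h1.trans (mul_le_mul_of_nonneg_left h3 (sq_nonneg M))
  have h5 := (sq_le_sq₀ (norm_nonneg _) (by positivity)).1 h4
  refine h5.trans ?_
  rw [mul_assoc]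
  exact mul_le_mul_of_nonneg_left (Φ.le_opNorm x) (by linarith)

theorem mild_const_eq_primitive (h : JointSemigroup S) (y : X) (t : ℝ) :
    mild S 0 (fun _ => y) t = h.primitive t y := by
  rw [mild, _root_.map_zero, zero_add, h.primitive_apply,
    intervalIntegral.integral_comp_sub_left (fun r => S r y) t]
  simp

/-- The feedback operator `-B* P`, where `P = Φ* Φ` is the value operator. -/
def optimalFeedback (B : U →L[𝕜] X) (Φ : X →L[𝕜] PairSpace X U) : X →L[𝕜] U :=
  -((B†).comp ((Φ†).comp Φ))

theorem inner_optimalFeedback (w : U) (p : X) :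
    inner 𝕜 w (optimalFeedback B Φ p) = -inner 𝕜 (Φ (B w)) (Φ p) := by
  simp only [optimalFeedback, neg_apply, ContinuousLinearMap.comp_apply, inner_neg_right,
    ContinuousLinearMap.adjoint_inner_right]

theorem continuous_primitive (h : JointSemigroup S) (y : X) : Continuous fun t => h.primitive t y := by
  simp only [h.primitive_apply]
  exact intervalIntegral.continuous_primitive
    (fun a b => (h.continuous_apply y).intervalIntegrable a b) 0

/-- In the first variation take the constant control `w` on `(0, τ]` followed by the optimal pair,
and divide by `τ → 0`. The state term vanishes in the limit since the perturbation starts at `0`;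
the tail tends to `⟪Φ (B w), Φ p⟫`, which fixes the limit of the control averages. -/
theorem tendsto_average_inner_control
    (hΦ : ∀ x, IsTrajectory S B x (Φ x) ∧ Φ x ∈ (nullPairs h B)ᗮ) (p : X) (w : U) :
    Tendsto (fun τ : ℝ => τ⁻¹ • ∫ t in (0 : ℝ)..τ, inner 𝕜 w (Φ p t).snd) (𝓝[>] 0)
      (𝓝 (inner 𝕜 w (optimalFeedback B Φ p))) := by
  have hT := jointSemigroup_optimalFlow hΦ
  have hz := continuous_primitive h (B w)
  have hc : Continuous fun t => inner 𝕜 (h.primitive t (B w)) (optimalFlow h B Φ t p) :=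
    hz.inner (hT.continuous_apply p)
  have hid : ∀ τ : ℝ, 0 < τ → τ⁻¹ • ∫ t in (0 : ℝ)..τ, inner 𝕜 w (Φ p t).snd =
      -(τ⁻¹ • ∫ t in (0 : ℝ)..τ, inner 𝕜 (h.primitive t (B w)) (optimalFlow h B Φ t p)) -
        inner 𝕜 (Φ (τ⁻¹ • h.primitive τ (B w))) (Φ (optimalFlow h B Φ τ p)) := fun τ hτ => by
    have hv := first_variation (hΦ p).2 hτ.le (w := w) (hΦ _).1
    have e1 : ∫ t in Set.Ioi (0 : ℝ), inner 𝕜 (Φ (mild S 0 (fun _ => B w) τ) t) (Φ p (t + τ)) =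
        inner 𝕜 (Φ (h.primitive τ (B w))) (Φ (optimalFlow h B Φ τ p)) := by
      rw [L2.inner_def, mild_const_eq_primitive h]
      refine integral_congr_ae ?_
      filter_upwards [ae_optimalFlow_shift hΦ p hτ.le] with t ht
      rw [ht]
    have e2 : ∫ t in (0 : ℝ)..τ, (inner 𝕜 (mild S 0 (fun _ => B w) t) (Φ p t).fst +
        inner 𝕜 w (Φ p t).snd) = (∫ t in (0 : ℝ)..τ, inner 𝕜 (h.primitive t (B w))
          (optimalFlow h B Φ t p)) + ∫ t in (0 : ℝ)..τ, inner 𝕜 w (Φ p t).snd := by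
      have hI : IntervalIntegrable (fun t => (inner 𝕜 w (Φ p t).snd : 𝕜)) volume 0 τ := by
        rw [intervalIntegrable_iff_integrableOn_Ioc_of_le hτ.le]
        exact (((memLp_snd (Lp.memLp (Φ p))).mono_measure (restrict_Ioc_le τ)).integrable
          one_le_two).const_inner w
      rw [← intervalIntegral.integral_add (hc.intervalIntegrable _ _) hI,
        intervalIntegral.integral_of_le hτ.le, intervalIntegral.integral_of_le hτ.le]
      refine integral_congr_ae ?_
      filter_upwards [ae_mono (restrict_Ioc_le τ) (ae_fst_eq_optimalFlow hΦ p)] with t ht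
      rw [ht, mild_const_eq_primitive h]
    rw [e1, e2] at hv
    have e3 : (inner 𝕜 (Φ (τ⁻¹ • h.primitive τ (B w))) (Φ (optimalFlow h B Φ τ p)) : 𝕜) =
        τ⁻¹ • inner 𝕜 (Φ (h.primitive τ (B w))) (Φ (optimalFlow h B Φ τ p)) := by
      rw [RCLike.real_smul_eq_coe_smul (K := 𝕜), _root_.map_smul, inner_smul_left, RCLike.conj_ofReal,
        RCLike.real_smul_eq_coe_mul]
    rw [e3, ← smul_neg, ← smul_sub]
    congr 1
    linear_combination hv
  have hlim1 : Tendsto (fun τ : ℝ => τ⁻¹ • ∫ t in (0 : ℝ)..τ,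
      inner 𝕜 (h.primitive t (B w)) (optimalFlow h B Φ t p)) (𝓝[>] 0) (𝓝 (0 : 𝕜)) := by
    have := tendsto_average_of_continuous (hc.comp continuous_snd)
    simpa [h.primitive_apply] using this
  have hlim2 : Tendsto (fun τ : ℝ => (inner 𝕜 (Φ (τ⁻¹ • h.primitive τ (B w)))
      (Φ (optimalFlow h B Φ τ p)) : 𝕜)) (𝓝[>] 0) (𝓝 (inner 𝕜 (Φ (B w)) (Φ p))) := by
    refine Tendsto.inner ((Φ.continuous.tendsto _).comp (h.tendsto_primitive (B w))) ?_
    exact (Φ.continuous.tendsto _).comp (hT.isC0Semigroup.tendsto_zero p)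
  have hlim := hlim1.neg.sub hlim2
  rw [inner_optimalFeedback]
  rw [neg_zero, zero_sub] at hlim
  refine hlim.congr' ?_
  filter_upwards [self_mem_nhdsWithin] with τ hτ
  exact (hid τ hτ).symm

/-- Lebesgue differentiation on each `[0, n]`, with a single null set serving all `n`. -/
theorem ae_tendsto_average_right {E : Type*} [NormedAddCommGroup E] [NormedSpace ℝ E]
    [CompleteSpace E] {u : ℝ → E} (hu : ∀ T, IntegrableOn u (Set.Ioc 0 T)) :
    ∀ᵐ a ∂(volume.restrict (Set.Ioi (0 : ℝ))),
      Tendsto (fun τ : ℝ => τ⁻¹ • ∫ t in (0 : ℝ)..τ, u (t + a)) (𝓝[>] 0) (𝓝 (u a)) := by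
  have hI : ∀ n : ℕ, IntervalIntegrable u volume 0 n := fun n => by
    rw [intervalIntegrable_iff_integrableOn_Ioc_of_le n.cast_nonneg]
    exact hu n
  have hall : ∀ᵐ a : ℝ, ∀ n : ℕ, a ∈ Set.uIcc (0 : ℝ) n → ∀ c ∈ Set.uIcc (0 : ℝ) n,
      HasDerivAt (fun x => ∫ t in c..x, u t) (u a) a :=
    ae_all_iff.2 fun n => (hI n).ae_hasDerivAt_integral
  rw [ae_restrict_iff' measurableSet_Ioi]
  filter_upwards [hall] with a ha ha0
  have ha0 : 0 < a := ha0
  obtain ⟨n, hn⟩ := exists_nat_ge a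
  have hmem : a ∈ Set.uIcc (0 : ℝ) n := by
    rw [Set.uIcc_of_le n.cast_nonneg]
    exact ⟨ha0.le, hn⟩
  have hd := (ha n hmem a hmem).tendsto_slope_zero_right
  refine hd.congr fun τ => ?_
  rw [intervalIntegral.integral_same, sub_zero, intervalIntegral.integral_comp_add_right, zero_add,
    add_comm]

/-- At a Lebesgue point `a` the averages over `(a, a + τ)` tend to the control at `a`. By Bellman's
principle they are averages from time `0` for the optimal pair of the state at `a`, whose limit is
the feedback value. -/
theorem ae_control_eq_optimalFeedback
    (hΦ : ∀ x, IsTrajectory S B x (Φ x) ∧ Φ x ∈ (nullPairs h B)ᗮ) (x : X) :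
    ∀ᵐ a ∂(volume.restrict (Set.Ioi (0 : ℝ))),
      (Φ x a).snd = optimalFeedback B Φ (optimalFlow h B Φ a x) := by
  have hu : ∀ T, IntegrableOn (fun t => (Φ x t).snd) (Set.Ioc 0 T) := fun T =>
    ((memLp_snd (Lp.memLp (Φ x))).mono_measure (restrict_Ioc_le T)).integrable one_le_two
  filter_upwards [ae_tendsto_average_right hu, ae_restrict_mem measurableSet_Ioi] with a ha ha0
  have ha0 : 0 < a := ha0
  refine ext_inner_left 𝕜 fun w => ?_
  have h1 := tendsto_average_inner_control hΦ (optimalFlow h B Φ a x) w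
  have h2 : Tendsto (fun τ : ℝ => (inner 𝕜 w (τ⁻¹ • ∫ t in (0 : ℝ)..τ, (Φ x (t + a)).snd) : 𝕜))
      (𝓝[>] 0) (𝓝 (inner 𝕜 w (Φ x a).snd)) :=
    tendsto_const_nhds.inner ha
  refine tendsto_nhds_unique h2 (h1.congr' ?_)
  filter_upwards [self_mem_nhdsWithin] with τ hτ
  have hτ : 0 < τ := hτ
  have e : ∫ t in (0 : ℝ)..τ, inner 𝕜 w (Φ (optimalFlow h B Φ a x) t).snd =
      ∫ t in Set.Ioc 0 τ, inner 𝕜 w (Φ x (t + a)).snd := by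
    rw [intervalIntegral.integral_of_le hτ.le]
    refine integral_congr_ae ?_
    filter_upwards [ae_mono (restrict_Ioc_le τ) (ae_optimalFlow_shift hΦ x ha0.le)] with t ht
    rw [ht]
  have hI : Integrable (fun t => (Φ x (t + a)).snd) (volume.restrict (Set.Ioc 0 τ)) :=
    ((memLp_snd (MemLp.shift (Lp.memLp (Φ x)) ha0.le)).mono_measure (restrict_Ioc_le τ)).integrable
      one_le_two
  rw [e, integral_inner hI, RCLike.real_smul_eq_coe_smul (K := 𝕜) (E := U), inner_smul_right,
    RCLike.real_smul_eq_coe_mul, intervalIntegral.integral_of_le hτ.le]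

/-- If every state is the start of a square integrable pair of norm controlled by that of the state,
then some bounded feedback produces a bounded closed-loop semigroup. -/
theorem exists_feedback (h : JointSemigroup S) (B : U →L[𝕜] X) {C : ℝ}
    (H : ∀ x : X, ∃ f : PairSpace X U, IsTrajectory S B x f ∧ ‖f‖ ≤ C * ‖x‖) :
    ∃ (K : X →L[𝕜] U) (T : ℝ → X →L[𝕜] X), JointSemigroup T ∧
      (∀ t, 0 ≤ t → ∀ x, T t x = mild S x (fun s => B (K (T s x))) t) ∧
      ∃ M : ℝ, 1 ≤ M ∧ ∀ t, 0 ≤ t → ‖T t‖ ≤ M := by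
  obtain ⟨Φ, hΦ⟩ := exists_optimalPair h B H
  refine ⟨optimalFeedback B Φ, optimalFlow h B Φ, jointSemigroup_optimalFlow hΦ, fun t ht x => ?_,
    exists_bound_optimalFlow hΦ⟩
  rw [optimalFlow_apply h B Φ ht]
  refine mild_congr ht ?_
  filter_upwards [ae_mono (restrict_Ioc_le t) (ae_control_eq_optimalFeedback hΦ x)] with s hs
  rw [forcing, hs]

end OptimalFlow

/-! ### Concatenating steering controls into a square integrable pair. -/

section OpenLoop

/-- The pieces `(nT, (n+1)T]`. -/
def timeSlice (T : ℝ) (n : ℕ) : Set ℝ := Set.Ioc (n * T) ((n + 1) * T)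

theorem iUnion_timeSlice {T : ℝ} (hT : 0 < T) : ⋃ n, timeSlice T n = Set.Ioi 0 := by
  ext t
  simp only [Set.mem_iUnion, timeSlice, Set.mem_Ioc, Set.mem_Ioi]
  constructor
  · rintro ⟨n, h1, -⟩
    exact lt_of_le_of_lt (by positivity) h1
  · intro ht
    have h0 : 0 < ⌈t / T⌉₊ := Nat.ceil_pos.2 (by positivity)
    obtain ⟨n, hn⟩ := Nat.exists_eq_succ_of_ne_zero h0.ne'
    have h1 := (Nat.ceil_eq_iff (Nat.succ_ne_zero n)).1 hn
    rw [Nat.succ_sub_one, lt_div_iff₀ hT, div_le_iff₀ hT] at h1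
    exact ⟨n, h1.1, by simpa using h1.2⟩

/-- Slices are open on the left and closed on the right, hence a ceiling minus one rather than a
floor. -/
theorem ceil_sub_one_of_mem_timeSlice {T t : ℝ} (hT : 0 < T) {n : ℕ} (ht : t ∈ timeSlice T n) :
    ⌈t / T⌉₊ - 1 = n := by
  have : ⌈t / T⌉₊ = n + 1 := by
    rw [Nat.ceil_eq_iff (Nat.succ_ne_zero n), Nat.succ_sub_one, lt_div_iff₀ hT, div_le_iff₀ hT]
    exact ⟨ht.1, by simpa using ht.2⟩
  omega

theorem measurePreserving_sub_timeSlice (T : ℝ) (n : ℕ) :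
    MeasurePreserving (fun t : ℝ => t - n * T) (volume.restrict (timeSlice T n))
      (volume.restrict (Set.Ioc 0 T)) := by
  have := (measurePreserving_sub_right (volume : Measure ℝ) (n * T)).restrict_preimage
    (measurableSet_Ioc (a := 0) (b := T))
  rw [Set.preimage_sub_const_Ioc, zero_add] at this
  rwa [timeSlice, add_mul, one_mul, add_comm (n * T) T]

/-- A function whose `L²` norms on the slices decay geometrically is square integrable. -/
theorem memLp_of_eLpNorm_timeSlice_le {E : Type*} [NormedAddCommGroup E] {g : ℝ → E} {T D α : ℝ}
    (hT : 0 < T) (hD : 0 ≤ D) (hα : 0 ≤ α) (hα1 : α < 1)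
    (hg : ∀ n, AEStronglyMeasurable g (volume.restrict (timeSlice T n)))
    (hb : ∀ n, eLpNorm g 2 (volume.restrict (timeSlice T n)) ≤ ENNReal.ofReal (D * α ^ n)) :
    MemLp g 2 (volume.restrict (Set.Ioi 0)) ∧
      eLpNorm g 2 (volume.restrict (Set.Ioi 0)) ≤ ENNReal.ofReal (D * √((1 - α ^ 2)⁻¹)) := by
  have hα2 : α ^ 2 < 1 := by nlinarith
  have hsum : HasSum (fun n : ℕ => D ^ 2 * (α ^ 2) ^ n) (D ^ 2 * (1 - α ^ 2)⁻¹) :=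
    (hasSum_geometric_of_lt_one (sq_nonneg α) hα2).mul_left _
  have hsq : ∀ μ : Measure ℝ, ∫⁻ t, ‖g t‖ₑ ^ (2 : ℝ) ∂μ = (eLpNorm g 2 μ) ^ (2 : ℝ) := fun μ => by
    rw [eLpNorm_eq_lintegral_rpow_enorm_toReal two_ne_zero ENNReal.ofNat_ne_top, ← ENNReal.rpow_mul]
    simp
  have hle : eLpNorm g 2 (volume.restrict (Set.Ioi 0)) ≤ ENNReal.ofReal (D * √((1 - α ^ 2)⁻¹)) := by
    rw [← ENNReal.rpow_le_rpow_iff (z := 2) two_pos, ← hsq, ← iUnion_timeSlice hT]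
    refine (lintegral_iUnion_le _ _).trans ?_
    have hterm : ∀ n, ∫⁻ t in timeSlice T n, ‖g t‖ₑ ^ (2 : ℝ) ≤
        ENNReal.ofReal (D ^ 2 * (α ^ 2) ^ n) := fun n => by
      rw [hsq]
      refine (ENNReal.rpow_le_rpow (hb n) two_pos.le).trans (le_of_eq ?_)
      rw [ENNReal.ofReal_rpow_of_nonneg (by positivity) two_pos.le]
      congr 1
      rw [Real.rpow_two]
      ring
    refine (ENNReal.tsum_le_tsum hterm).trans (le_of_eq ?_)
    rw [← ENNReal.ofReal_tsum_of_nonneg (fun n => by positivity) hsum.summable, hsum.tsum_eq,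
      ENNReal.ofReal_rpow_of_nonneg (by positivity) two_pos.le, Real.rpow_two, mul_pow,
      Real.sq_sqrt (inv_nonneg.2 (by linarith))]
  refine ⟨⟨?_, hle.trans_lt ENNReal.ofReal_lt_top⟩, hle⟩
  rw [← iUnion_timeSlice hT]
  exact (aestronglyMeasurable_iUnion_iff).2 hg

variable {𝕜 X U : Type*} [RCLike 𝕜]
  [NormedAddCommGroup X] [InnerProductSpace 𝕜 X] [CompleteSpace X]
  [NormedAddCommGroup U] [InnerProductSpace 𝕜 U] [CompleteSpace U]
  {S : ℝ → X →L[𝕜] X}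

/-- The concatenation of the controls `v n`, each used on the slice `(nT, (n+1)T]`. -/
def concatControl {T : ℝ} (v : ℕ → Control U T) (t : ℝ) : U :=
  v (⌈t / T⌉₊ - 1) (t - (⌈t / T⌉₊ - 1 : ℕ) * T)

theorem concatControl_of_mem {T t : ℝ} (hT : 0 < T) (v : ℕ → Control U T) {n : ℕ}
    (ht : t ∈ timeSlice T n) : concatControl v t = v n (t - n * T) := by
  rw [concatControl, ceil_sub_one_of_mem_timeSlice hT ht]

theorem concatControl_add {T t : ℝ} (hT : 0 < T) (v : ℕ → Control U T) {n : ℕ}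
    (ht : t ∈ Set.Ioc 0 T) : concatControl v (t + n * T) = v n t := by
  rw [concatControl_of_mem hT v (n := n) ⟨by linarith [ht.1], by linarith [ht.2]⟩,
    add_sub_cancel_right]

theorem eLpNorm_concatControl {T : ℝ} (hT : 0 < T) (v : ℕ → Control U T) (n : ℕ) :
    AEStronglyMeasurable (concatControl v) (volume.restrict (timeSlice T n)) ∧
    eLpNorm (concatControl v) 2 (volume.restrict (timeSlice T n)) = ENNReal.ofReal ‖v n‖ := by
  have hm := measurePreserving_sub_timeSlice T n
  have e : concatControl v =ᵐ[volume.restrict (timeSlice T n)] (v n) ∘ fun t => t - n * T := by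
    filter_upwards [ae_restrict_mem measurableSet_Ioc] with t ht
    exact concatControl_of_mem hT v ht
  constructor
  · exact ((Lp.aestronglyMeasurable (v n)).comp_measurePreserving hm).congr e.symm
  · rw [eLpNorm_congr_ae e, eLpNorm_comp_measurePreserving (Lp.aestronglyMeasurable _) hm,
      Lp.norm_def, ENNReal.ofReal_toReal (Lp.memLp _).2.ne]

theorem memLp_concatControl {T D α : ℝ} (hT : 0 < T) (hD : 0 ≤ D) (hα : 0 ≤ α) (hα1 : α < 1)
    {v : ℕ → Control U T} (hv : ∀ n, ‖v n‖ ≤ D * α ^ n) :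
    MemLp (concatControl v) 2 (volume.restrict (Set.Ioi 0)) :=
  (memLp_of_eLpNorm_timeSlice_le hT hD hα hα1 (fun n => (eLpNorm_concatControl hT v n).1)
    fun n => by
      rw [(eLpNorm_concatControl hT v n).2]
      exact ENNReal.ofReal_le_ofReal (hv n)).1

/-- Repeated steering with a contraction factor produces square integrable pairs. -/
theorem exists_pair_of_steersWithCost [NormedSpace ℝ U] (h : JointSemigroup S) (B : U →L[𝕜] X)
    {T α C : ℝ} (hT : 0 < T) (hα : 0 ≤ α) (hα1 : α < 1) (hC : 0 ≤ C)
    (H : SteersWithCost S B T α C) :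
    letI : NormedSpace ℝ X := NormedSpace.restrictScalars ℝ 𝕜 X
    ∃ C' : ℝ, ∀ x : X, ∃ f : PairSpace X U, IsTrajectory S B x f ∧ ‖f‖ ≤ C' * ‖x‖ := by
  let _ : NormedSpace ℝ X := NormedSpace.restrictScalars ℝ 𝕜 X
  obtain ⟨M, hM1, hM⟩ := h.isC0Semigroup.exists_bound T
  choose F hF1 hF2 using H
  -- Bound for the state within one slice relative to the state at its left end: free evolution plus
  -- the effect of a control of norm at most `C ‖y n‖`.
  let D₁ : ℝ := M + M * (‖B‖ * (√T * C))
  have hD₁ : 0 ≤ D₁ := by positivity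
  -- One slice contributes an `L²` norm of at most `(D₁ √T + C) ‖y n‖` with `‖y n‖ ≤ α ^ n ‖x‖`; the
  -- last factor sums the squares geometrically.
  refine ⟨(D₁ * √T + C) * √((1 - α ^ 2)⁻¹), fun x => ?_⟩
  -- The states reached at the times `n T` by steering anew on each slice.
  let y : ℕ → X := fun n => Nat.rec x (fun _ z => endState S B T z (F z)) n
  have hy0 : y 0 = x := rfl
  have hys : ∀ n, y (n + 1) = endState S B T (y n) (F (y n)) := fun n => rfl
  have hy : ∀ n, ‖y n‖ ≤ ‖x‖ * α ^ n := fun n => by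
    induction n with
    | zero => simp [hy0]
    | succ n ih =>
      rw [hys, pow_succ]
      refine (hF1 _).trans ?_
      have := mul_le_mul_of_nonneg_left ih hα
      linarith
  let v : ℕ → Control U T := fun n => F (y n)
  have hv : ∀ n, ‖v n‖ ≤ C * ‖y n‖ := fun n => hF2 _
  have hv' : ∀ n, ‖v n‖ ≤ (C * ‖x‖) * α ^ n := fun n =>
    (hv n).trans ((mul_le_mul_of_nonneg_left (hy n) hC).trans (le_of_eq (by ring)))
  let u := concatControl v
  have huL : MemLp u 2 (volume.restrict (Set.Ioi 0)) :=
    memLp_concatControl hT (by positivity) hα hα1 hv'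
  have hg : ∀ t, IntegrableOn (fun s => B (u s)) (Set.Ioc 0 t) := fun t =>
    integrableOn_control B (huL.mono_measure (restrict_Ioc_le t))
  have hcong : ∀ (n : ℕ) (t : ℝ), 0 ≤ t → t ≤ T → ∀ z,
      mild S z (fun s => B (u (s + n * T))) t = mild S z (fun s => B (v n s)) t :=
    fun n t ht htT z => by
      refine mild_congr ht ?_
      filter_upwards [ae_restrict_mem measurableSet_Ioc] with s hs
      exact congrArg B (concatControl_add hT v ⟨hs.1, hs.2.trans htT⟩)
  have hstate : ∀ n : ℕ, mild S x (fun s => B (u s)) (n * T) = y n := fun n => by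
    induction n with
    | zero => simp [mild, hy0, h.map_zero]
    | succ n ih =>
      rw [Nat.cast_succ, add_mul, one_mul, add_comm, h.mild_add_time x (by positivity) hT.le (hg _),
        ih, hcong n T hT.le le_rfl, hys]
      rfl
  have hbound : ∀ n, ∀ t ∈ timeSlice T n, ‖mild S x (fun s => B (u s)) t‖ ≤ D₁ * ‖y n‖ := by
    intro n t ht
    have ht0 : 0 ≤ t - n * T := by linarith [ht.1]
    have ht1 : t - n * T ≤ T := by linarith [ht.2]
    have e := h.mild_add_time (s := n * T) (t := t - n * T) x (by positivity) ht0 (hg _)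
    rw [sub_add_cancel, hstate, hcong n _ ht0 ht1] at e
    have hvL : MemLp (v n) 2 (volume.restrict (Set.Ioc 0 (t - n * T))) :=
      (Lp.memLp (v n)).mono_measure (Measure.restrict_mono (Set.Ioc_subset_Ioc_right ht1) le_rfl)
    have h1 := norm_mild_le (S := S) (y n) ht0 (integrableOn_control B hvL)
      (fun s h0 h1 => hM s h0 (h1.trans ht1))
    have h2 : ∫ s in (0 : ℝ)..(t - n * T), ‖B (v n s)‖ ≤
        ‖B‖ * ∫ s in (0 : ℝ)..(t - n * T), ‖v n s‖ := by
      rw [← intervalIntegral.integral_const_mul]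
      refine intervalIntegral.integral_mono_on ht0 ?_ ?_ fun s _ => B.le_opNorm _
      · rw [intervalIntegrable_iff_integrableOn_Ioc_of_le ht0]
        exact (integrableOn_control B hvL).norm
      · rw [intervalIntegrable_iff_integrableOn_Ioc_of_le ht0]
        exact (hvL.integrable one_le_two).norm.const_mul _
    have h3 := integral_norm_le_sqrt_mul_eLpNorm ht0 hvL
    have h4 : (eLpNorm (v n) 2 (volume.restrict (Set.Ioc 0 (t - n * T)))).toReal ≤ C * ‖y n‖ := by
      refine le_trans ?_ (hv n)
      rw [Lp.norm_def]
      exact ENNReal.toReal_mono (Lp.memLp (v n)).2.ne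
        (eLpNorm_mono_measure _ (Measure.restrict_mono (Set.Ioc_subset_Ioc_right ht1) le_rfl))
    have h5 : √(t - n * T - 0) ≤ √T := Real.sqrt_le_sqrt (by linarith)
    have h6 : ∫ s in (0 : ℝ)..(t - n * T), ‖B (v n s)‖ ≤ ‖B‖ * (√T * (C * ‖y n‖)) := by
      refine h2.trans (mul_le_mul_of_nonneg_left (h3.trans ?_) (norm_nonneg B))
      exact mul_le_mul h5 h4 ENNReal.toReal_nonneg (Real.sqrt_nonneg T)
    rw [e]
    refine h1.trans ?_
    have := mul_le_mul_of_nonneg_left h6 (by linarith : 0 ≤ M)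
    calc _ ≤ M * ‖y n‖ + M * (‖B‖ * (√T * (C * ‖y n‖))) := by linarith
      _ = D₁ * ‖y n‖ := by ring
  let f : ℝ → WithLp 2 (X × U) := fun t => WithLp.toLp 2 (mild S x (fun s => B (u s)) t, u t)
  have hslice : ∀ n, timeSlice T n ⊆ Set.Icc 0 ((n + 1) * T) := fun n t ht =>
    ⟨(lt_of_le_of_lt (by positivity) ht.1).le, ht.2⟩
  have hfm : ∀ n, AEStronglyMeasurable f (volume.restrict (timeSlice T n)) := fun n => by
    refine (WithLp.prod_continuous_toLp 2 X U).comp_aestronglyMeasurable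
      (AEStronglyMeasurable.prodMk ?_ (eLpNorm_concatControl hT v n).1)
    exact ((h.continuousOn_mild x (hg ((n + 1) * T))).mono (hslice n)).aestronglyMeasurable
      measurableSet_Ioc
  have hfb : ∀ n, eLpNorm f 2 (volume.restrict (timeSlice T n)) ≤
      ENNReal.ofReal (((D₁ * √T + C) * ‖x‖) * α ^ n) := fun n => by
    have h1 : ∀ᵐ t ∂(volume.restrict (timeSlice T n)), ‖f t‖ ≤ ‖D₁ * ‖y n‖ + ‖u t‖‖ := by
      filter_upwards [ae_restrict_mem measurableSet_Ioc] with t ht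
      rw [Real.norm_of_nonneg (by positivity)]
      have h2 : ‖f t‖ ≤ ‖mild S x (fun s => B (u s)) t‖ + ‖u t‖ := by
        have h3 := WithLp.prod_norm_sq_eq_of_L2 (f t)
        refine abs_le_of_sq_le_sq' (b := _) ?_ (by positivity) |>.2
        rw [h3]
        change ‖mild S x (fun s => B (u s)) t‖ ^ 2 + ‖u t‖ ^ 2 ≤ _
        nlinarith [mul_nonneg (norm_nonneg (mild S x (fun s => B (u s)) t)) (norm_nonneg (u t))]
      exact h2.trans (by gcongr; exact hbound n t ht)
    have hun := eLpNorm_concatControl hT v n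
    calc eLpNorm f 2 (volume.restrict (timeSlice T n))
        ≤ eLpNorm (fun t => D₁ * ‖y n‖ + ‖u t‖) 2 (volume.restrict (timeSlice T n)) :=
          eLpNorm_mono_ae h1
      _ ≤ eLpNorm (fun _ => D₁ * ‖y n‖) 2 (volume.restrict (timeSlice T n)) +
          eLpNorm (fun t => ‖u t‖) 2 (volume.restrict (timeSlice T n)) :=
          eLpNorm_add_le aestronglyMeasurable_const hun.1.norm one_le_two
      _ ≤ ENNReal.ofReal (D₁ * ‖y n‖ * √T) + ENNReal.ofReal (C * ‖y n‖) := by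
          refine add_le_add (le_of_eq ?_) ?_
          · rw [eLpNorm_const' _ two_ne_zero ENNReal.ofNat_ne_top, Measure.restrict_apply_univ,
              timeSlice, Real.volume_Ioc, Real.enorm_eq_ofReal (by positivity),
              show ((n : ℝ) + 1) * T - n * T = T by ring,
              ENNReal.ofReal_rpow_of_nonneg hT.le (by norm_num),
              ← ENNReal.ofReal_mul (by positivity), Real.sqrt_eq_rpow]
            norm_num
          · rw [eLpNorm_norm, hun.2]
            exact ENNReal.ofReal_le_ofReal (hv n)
      _ = ENNReal.ofReal ((D₁ * √T + C) * ‖y n‖) := by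
          rw [← ENNReal.ofReal_add (by positivity) (by positivity)]
          congr 1
          ring
      _ ≤ _ := by
          refine ENNReal.ofReal_le_ofReal ?_
          rw [mul_assoc]
          exact mul_le_mul_of_nonneg_left (hy n) (by positivity)
  obtain ⟨hfL, hfn⟩ := memLp_of_eLpNorm_timeSlice_le hT (by positivity) hα hα1 hfm hfb
  refine ⟨hfL.toLp f, ?_, ?_⟩
  · refine IsTrajectory.congr (f := f) ?_ hfL.coeFn_toLp.symm
    exact Eventually.of_forall fun t => rfl
  · rw [Lp.norm_toLp]
    refine (ENNReal.toReal_le_of_le_ofReal (by positivity) hfn).trans (le_of_eq ?_)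
    ring

end OpenLoop

/-! ### Variation of constants and the generator `A + BK`. -/

section ClosedLoop

variable {𝕜 X U : Type*} [RCLike 𝕜]
  [NormedAddCommGroup X] [InnerProductSpace 𝕜 X] [CompleteSpace X]
  [NormedAddCommGroup U] [InnerProductSpace 𝕜 U] [CompleteSpace U]
  {A : X →ₗ.[𝕜] X} {S T : ℝ → X →L[𝕜] X} {B : U →L[𝕜] X} {K : X →L[𝕜] U}

theorem mem_graph_closedLoop (x y : X) :
    (x, y) ∈ (closedLoop A B K).graph ↔ (x, y - B (K x)) ∈ A.graph := by
  rw [LinearPMap.mem_graph_iff, LinearPMap.mem_graph_iff]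
  constructor
  · rintro ⟨⟨z, hz⟩, h1, h2⟩
    simp only at h1 h2
    subst h1
    refine ⟨⟨z, hz⟩, rfl, ?_⟩
    rw [← h2]
    exact (add_sub_cancel_left (B (K z)) (A ⟨z, hz⟩)).symm
  · rintro ⟨⟨z, hz⟩, h1, h2⟩
    simp only at h1 h2
    subst h1
    refine ⟨⟨z, hz⟩, rfl, ?_⟩
    change B (K z) + A ⟨z, hz⟩ = y
    rw [h2, add_sub_cancel]

/-- The generator only depends on the semigroup at nonnegative times. -/
theorem Generates.freeze (hA : Generates A S) : Generates A fun t => S (max t 0) where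
  isC0Semigroup := hA.isC0Semigroup.jointSemigroup.isC0Semigroup
  mem_graph_iff x y := by
    rw [hA.mem_graph_iff]
    refine tendsto_congr' ?_
    filter_upwards [self_mem_nhdsWithin] with t ht
    rw [max_eq_left (le_of_lt ht)]

variable [NormedSpace ℝ X]

theorem Generates.mem_graph_iff_real (hA : Generates A S) (x y : X) : (x, y) ∈ A.graph ↔
    Tendsto (fun t : ℝ => t⁻¹ • (S t x - x)) (𝓝[>] 0) (𝓝 y) := by
  rw [hA.mem_graph_iff]
  refine tendsto_congr fun t => ?_
  rw [RCLike.real_smul_eq_coe_smul (K := 𝕜), RCLike.ofReal_inv]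

/-- A semigroup satisfying the variation of constants formula for the feedback `K` is generated by
`A + BK`. -/
theorem generates_closedLoop (hA : Generates A S) (h : JointSemigroup S) (hT : JointSemigroup T)
    (hmild : ∀ t, 0 ≤ t → ∀ x, T t x = mild S x (fun s => B (K (T s x))) t) :
    Generates (closedLoop A B K) T where
  isC0Semigroup := hT.isC0Semigroup
  mem_graph_iff x y := by
    have hF : Continuous fun p : ℝ × ℝ => S (p.1 - p.2) (B (K (T p.2 x))) :=
      h.continuous.comp ((continuous_fst.sub continuous_snd).prodMk
        (B.continuous.comp (K.continuous.comp ((hT.continuous_apply x).comp continuous_snd))))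
    -- The difference quotients of `T` and `S` at `x` differ by this average, which tends to `B (K
    -- x)`; hence one converges exactly when the other does.
    have hav := tendsto_average_of_continuous hF
    simp only [sub_self, h.apply_zero, hT.apply_zero] at hav
    have hid : ∀ t : ℝ, 0 < t → t⁻¹ • (T t x - x) =
        t⁻¹ • (S t x - x) + t⁻¹ • ∫ s in (0 : ℝ)..t, S (t - s) (B (K (T s x))) := fun t ht => by
      rw [hmild t ht.le x, mild, ← smul_add]
      congr 1
      abel
    rw [mem_graph_closedLoop, hA.mem_graph_iff_real]
    have hscalar : Tendsto (fun t : ℝ => ((t : 𝕜)⁻¹) • (T t x - x)) (𝓝[>] 0) (𝓝 y) ↔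
        Tendsto (fun t : ℝ => t⁻¹ • (T t x - x)) (𝓝[>] 0) (𝓝 y) := by
      refine tendsto_congr fun t => ?_
      rw [RCLike.real_smul_eq_coe_smul (K := 𝕜), RCLike.ofReal_inv]
    rw [hscalar]
    constructor
    · intro H
      have := H.add hav
      rw [sub_add_cancel] at this
      refine this.congr' ?_
      filter_upwards [self_mem_nhdsWithin] with t ht
      exact (hid t ht).symm
    · intro H
      refine (H.sub hav).congr' ?_
      filter_upwards [self_mem_nhdsWithin] with t ht
      rw [hid t ht, add_sub_cancel_right]

/-- Both sides equal the integral over `(r, r + t]` minus that over `(0, t]`. The symmetry in `r`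
and `t` shows that `primitive r x` lies in the domain of the generator. -/
theorem JointSemigroup.primitive_apply_sub (h : JointSemigroup S) {r t : ℝ} (hr : 0 ≤ r)
    (ht : 0 ≤ t) (x : X) :
    S t (h.primitive r x) - h.primitive r x = h.primitive t (S r x) - h.primitive t x := by
  have hc := fun a b => (h.continuous_apply x).intervalIntegrable (μ := volume) a b
  have e : ∀ a b : ℝ, 0 ≤ a → 0 ≤ b → (∫ s in (0 : ℝ)..a, S (s + b) x) = ∫ s in b..(a + b), S s x :=
    fun a b _ _ => by
      rw [intervalIntegral.integral_comp_add_right (fun s => S s x), zero_add]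
  have e1 : S t (h.primitive r x) = ∫ s in t..(r + t), S s x := by
    rw [← e r t hr ht, h.primitive_apply, ← ContinuousLinearMap.intervalIntegral_comp_comm _ (hc _ _)]
    refine intervalIntegral.integral_congr fun s hs => ?_
    rw [Set.uIcc_of_le hr] at hs
    rw [add_comm, h.map_add_apply ht hs.1]
  have e2 : h.primitive t (S r x) = ∫ s in r..(t + r), S s x := by
    rw [← e t r ht hr, h.primitive_apply]
    refine intervalIntegral.integral_congr fun s hs => ?_
    rw [Set.uIcc_of_le ht] at hs
    exact (h.map_add_apply hs.1 hr x).symm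
  rw [e1, e2, h.primitive_apply, h.primitive_apply, add_comm t r,
    ← intervalIntegral.integral_add_adjacent_intervals (hc t r) (hc r _),
    ← intervalIntegral.integral_add_adjacent_intervals (hc 0 t) (hc t r)]
  abel

theorem tendsto_comp_sub_right {E : Type*} [TopologicalSpace E] {f : ℝ → E} {y : E} (s : ℝ)
    (hf : Tendsto f (𝓝[>] 0) (𝓝 y)) : Tendsto (fun r => f (r - s)) (𝓝[>] s) (𝓝 y) := by
  refine hf.comp (tendsto_nhdsWithin_iff.2 ⟨?_, ?_⟩)
  · have : Continuous fun r : ℝ => r - s := by fun_prop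
    have := this.tendsto s
    rw [sub_self] at this
    exact this.mono_left nhdsWithin_le_nhds
  · filter_upwards [self_mem_nhdsWithin] with r hr
    exact Set.mem_Ioi.2 (sub_pos.2 (Set.mem_Ioi.1 hr))

/-- The variation of constants formula on the domain of the closed-loop generator. -/
theorem mild_of_mem_domain (hA : Generates A S) (h : JointSemigroup S)
    (hK : Generates (closedLoop A B K) T) (hT : JointSemigroup T) {t : ℝ} (ht : 0 ≤ t) {x y : X}
    (hxy : Tendsto (fun t : ℝ => t⁻¹ • (T t x - x)) (𝓝[>] 0) (𝓝 y)) :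
    T t x = mild S x (fun s => B (K (T s x))) t := by
  have hcT := hT.continuous_apply x
  have hφ : Continuous fun s => S (t - s) (T s x) :=
    h.continuous.comp ((continuous_const.sub continuous_id).prodMk hcT)
  have hφ' : Continuous fun s => S (t - s) (B (K (T s x))) :=
    h.continuous.comp ((continuous_const.sub continuous_id).prodMk
      (B.continuous.comp (K.continuous.comp hcT)))
  -- Along the path `S (t - s) (T s x)` the contributions of `A` cancel and only `BK` remains. A
  -- right derivative suffices for the fundamental theorem of calculus.
  have hderiv : ∀ s ∈ Set.Ioo (min 0 t) (max 0 t),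
      HasDerivWithinAt (fun s => S (t - s) (T s x)) (S (t - s) (B (K (T s x)))) (Set.Ioi s) s := by
    intro s hs
    rw [min_eq_left ht, max_eq_right ht] at hs
    have hz : Tendsto (fun r : ℝ => r⁻¹ • (T r (T s x) - T s x)) (𝓝[>] 0) (𝓝 (T s y)) := by
      refine (((T s).continuous.tendsto y).comp hxy).congr' ?_
      filter_upwards [self_mem_nhdsWithin] with r hr
      rw [← hT.map_add_apply (le_of_lt hr) hs.1.le, add_comm, hT.map_add_apply hs.1.le (le_of_lt hr),
        ← _root_.map_sub, Function.comp_apply, RCLike.real_smul_eq_coe_smul (K := 𝕜),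
        RCLike.real_smul_eq_coe_smul (K := 𝕜), _root_.map_smul]
    have hzA := (hA.mem_graph_iff_real _ _).1
      ((mem_graph_closedLoop (T s x) (T s y)).1 ((hK.mem_graph_iff_real _ _).2 hz))
    have hdiff := tendsto_comp_sub_right s (hz.sub hzA)
    rw [sub_sub_cancel] at hdiff
    -- Factoring out `S (t - r)` leaves the difference of the quotients of `T` and `S` at `T s x`;
    -- joint continuity handles the moving factor.
    have hlim : Tendsto (fun r => S (t - r) ((r - s)⁻¹ • (T (r - s) (T s x) - T s x) -
        (r - s)⁻¹ • (S (r - s) (T s x) - T s x))) (𝓝[>] s) (𝓝 (S (t - s) (B (K (T s x))))) := by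
      refine (h.continuous.tendsto (t - s, B (K (T s x)))).comp (Tendsto.prodMk_nhds ?_ hdiff)
      have : Continuous fun r : ℝ => t - r := by fun_prop
      exact (this.tendsto s).mono_left nhdsWithin_le_nhds
    rw [hasDerivWithinAt_iff_tendsto_slope' (by simp)]
    refine hlim.congr' ?_
    filter_upwards [self_mem_nhdsWithin, Ioo_mem_nhdsGT hs.2] with r hr hrt
    have hr : s < r := hr
    have e1 : T r x = T (r - s) (T s x) := by
      rw [← hT.map_add_apply (by linarith) hs.1.le, sub_add_cancel]
    have e2 : S (t - s) (T s x) = S (t - r) (S (r - s) (T s x)) := by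
      rw [← h.map_add_apply (by linarith [hrt.2]) (by linarith)]
      congr 2
      ring
    rw [slope_def_module, e1, e2, ← smul_sub, sub_sub_sub_cancel_right,
      RCLike.real_smul_eq_coe_smul (K := 𝕜), _root_.map_smul, _root_.map_sub,
      ← RCLike.real_smul_eq_coe_smul (K := 𝕜)]
  have hint := intervalIntegral.integral_eq_sub_of_hasDeriv_right hφ.continuousOn hderiv
    (hφ'.intervalIntegrable 0 t)
  rw [sub_self, sub_zero, h.apply_zero, hT.apply_zero] at hint
  rw [mild, hint, add_sub_cancel]

/-- The variation of constants formula for the closed-loop semigroup. -/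
theorem mild_of_generates_closedLoop (hA : Generates A S) (h : JointSemigroup S)
    (hK : Generates (closedLoop A B K) T) (hT : JointSemigroup T) {t : ℝ} (ht : 0 ≤ t) (x : X) :
    T t x = mild S x (fun s => B (K (T s x))) t := by
  have hcl : IsClosed {x : X | T t x = mild S x (fun s => B (K (T s x))) t} := by
    refine isClosed_eq (T t).continuous ((S t).continuous.add ?_)
    refine intervalIntegral.continuous_parametric_intervalIntegral_of_continuous'
      (f := fun x s => S (t - s) (B (K (T s x)))) ?_ 0 t
    exact h.continuous.comp ((continuous_const.sub continuous_snd).prodMk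
      (B.continuous.comp (K.continuous.comp (hT.continuous.comp continuous_swap))))
  -- Both sides are continuous in `x`, and the averages `r⁻¹ • primitive r x` lie in the domain and
  -- converge to `x`.
  refine hcl.mem_of_tendsto (hT.tendsto_primitive x) ?_
  filter_upwards [self_mem_nhdsWithin] with r hr
  have hr : 0 < r := hr
  refine mild_of_mem_domain hA h hK hT ht (y := r⁻¹ • (T r x - x)) ?_
  have h1 := ((hT.tendsto_primitive (T r x)).sub (hT.tendsto_primitive x)).const_smul r⁻¹
  refine h1.congr' ?_
  filter_upwards [self_mem_nhdsWithin] with s hs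
  have hs : 0 < s := hs
  rw [← smul_sub, ← hT.primitive_apply_sub hr.le hs.le, smul_comm]
  congr 1
  rw [RCLike.real_smul_eq_coe_smul (K := 𝕜), RCLike.real_smul_eq_coe_smul (K := 𝕜),
    _root_.map_smul, smul_sub]

/-- The variation of constants formula is compatible with rescaling. -/
theorem rescale_mild {δ : ℝ}
    (hmild : ∀ t, 0 ≤ t → ∀ x, T t x =
      mild (fun r => ((Real.exp (δ * r) : ℝ) : 𝕜) • S r) x (fun s => B (K (T s x))) t)
    {t : ℝ} (ht : 0 ≤ t) (x : X) :
    (((Real.exp (-δ * t) : ℝ) : 𝕜) • T t) x =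
      mild S x (fun s => B (K ((((Real.exp (-δ * s) : ℝ) : 𝕜) • T s) x))) t := by
  rw [smul_apply, hmild t ht x, mild, mild, smul_add, smul_apply, smul_smul, ← RCLike.ofReal_mul,
    ← Real.exp_add, show -δ * t + δ * t = 0 by ring, Real.exp_zero, RCLike.ofReal_one, one_smul,
    ← intervalIntegral.integral_smul]
  congr 1
  refine intervalIntegral.integral_congr fun s _ => ?_
  simp only [smul_apply, _root_.map_smul, smul_smul, ← RCLike.ofReal_mul, ← Real.exp_add]
  congr 3
  ring

end ClosedLoop

/-! ### Rescaling, and steering by a closed loop. -/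

section Rates

variable {𝕜 X U : Type*} [RCLike 𝕜]
  [NormedAddCommGroup X] [InnerProductSpace 𝕜 X] [CompleteSpace X]
  [NormedAddCommGroup U] [InnerProductSpace 𝕜 U] [CompleteSpace U]
  {A : X →ₗ.[𝕜] X} {S T : ℝ → X →L[𝕜] X} {B : U →L[𝕜] X} {K : X →L[𝕜] U}

theorem norm_adjoint_rescale (δ t : ℝ) (ψ : X) :
    ‖(((((Real.exp (δ * t) : ℝ) : 𝕜) • S t)†) ψ)‖ = Real.exp (δ * t) * ‖((S t)†) ψ‖ := by
  rw [map_smulₛₗ, smul_apply, norm_smul, RCLike.norm_conj, RCLike.norm_ofReal, Real.abs_exp]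

/-- The observation involves only times `τ - t ≥ 0`, where `e^{δ(τ - t)} ≥ 1`, so rescaling does not
decrease it; the inequality is then multiplied by `e^{δτ}`. -/
theorem WeakObservability.rescale (h : JointSemigroup S) {τ α C δ : ℝ} (hτ : 0 ≤ τ) (hδ : 0 ≤ δ)
    (hC : 0 ≤ C) (H : WeakObservability S B τ α C) :
    WeakObservability (fun t => ((Real.exp (δ * t) : ℝ) : 𝕜) • S t) B τ (Real.exp (δ * τ) * α)
      (Real.exp (δ * τ) * C) := by
  intro ψ
  have hobs : obsNorm S B τ ψ ≤ obsNorm (fun t => ((Real.exp (δ * t) : ℝ) : 𝕜) • S t) B τ ψ := by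
    refine Real.sqrt_le_sqrt (intervalIntegral.integral_mono_on hτ ?_ ?_ fun t ht => ?_)
    · refine ContinuousOn.intervalIntegrable ?_
      rw [Set.uIcc_of_le hτ]
      exact (continuousOn_observation h B τ ψ).norm.pow 2
    · refine ContinuousOn.intervalIntegrable ?_
      rw [Set.uIcc_of_le hτ]
      exact (continuousOn_observation (h.rescale δ) B τ ψ).norm.pow 2
    · refine pow_le_pow_left₀ (norm_nonneg _) ?_ 2
      rw [map_smulₛₗ, smul_apply, _root_.map_smul, norm_smul, RCLike.norm_conj, RCLike.norm_ofReal,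
        Real.abs_exp]
      exact le_mul_of_one_le_left (norm_nonneg _)
        (Real.one_le_exp (mul_nonneg hδ (by linarith [ht.2])))
  rw [norm_adjoint_rescale]
  have h1 := H ψ
  have h2 := mul_le_mul_of_nonneg_left hobs hC
  calc _ ≤ Real.exp (δ * τ) * (C * obsNorm (fun t => ((Real.exp (δ * t) : ℝ) : 𝕜) • S t) B τ ψ +
        α * ‖ψ‖) := mul_le_mul_of_nonneg_left (by linarith) (Real.exp_pos _).le
    _ = _ := by ring

/-- Weak observability yields feedbacks with every decay rate below `-ln α / τ`. -/
theorem exists_feedback_of_weakObservability (hA : Generates A S) (h : JointSemigroup S)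
    {τ α C δ : ℝ} (hτ : 0 < τ) (hα : 0 ≤ α) (hC : 0 ≤ C) (hδ : 0 ≤ δ)
    (hαδ : Real.exp (δ * τ) * α < 1) (H : WeakObservability S B τ α C) :
    ∃ (K : X →L[𝕜] U) (T : ℝ → X →L[𝕜] X), Generates (closedLoop A B K) T ∧ HasGrowthRate T (-δ) := by
  let _ : NormedSpace ℝ X := NormedSpace.restrictScalars ℝ 𝕜 X
  let _ : NormedSpace ℝ U := NormedSpace.restrictScalars ℝ 𝕜 U
  -- The optimal feedback is built for `e^{δt} S(t)`, where the contraction factor `e^{δτ} α` is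
  -- still below `1`.
  have hS := (steersWithCost_iff (h.rescale δ) B hτ.le (by positivity) (by positivity)).2
    (H.rescale h hτ.le hδ hC)
  obtain ⟨C', hC'⟩ := exists_pair_of_steersWithCost (h.rescale δ) B hτ (by positivity) hαδ
    (by positivity) hS
  obtain ⟨K, T, hT, hmild, M, hM1, hM⟩ := exists_feedback (h.rescale δ) B hC'
  refine ⟨K, fun t => ((Real.exp (-δ * t) : ℝ) : 𝕜) • T t,
    generates_closedLoop hA h (hT.rescale (-δ)) fun t ht x => rescale_mild hmild ht x,
    M, hM1, fun t ht => ?_⟩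
  rw [norm_smul, RCLike.norm_ofReal, Real.abs_exp, mul_comm]
  exact mul_le_mul_of_nonneg_right (hM t ht) (Real.exp_pos _).le

/-- A closed-loop semigroup steers with the factor given by its norm. -/
theorem steersWithCost_of_generates_closedLoop (hA : Generates A S) (h : JointSemigroup S)
    (hK : Generates (closedLoop A B K) T) {τ α : ℝ} (hτ : 0 ≤ τ) (hα : ‖T τ‖ ≤ α) :
    ∃ C : ℝ, 0 < C ∧ SteersWithCost S B τ α C := by
  let _ : NormedSpace ℝ X := NormedSpace.restrictScalars ℝ 𝕜 X
  have hT := hK.isC0Semigroup.jointSemigroup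
  obtain ⟨M, hM1, hM⟩ := hK.isC0Semigroup.exists_bound τ
  -- The norm of the embedding of bounded functions on `(0, τ]` into `L²`, namely `√τ`; the `+ 1`
  -- below only makes the cost strictly positive.
  let m : ℝ := (measureUnivNNReal (volume.restrict (Set.Ioc 0 τ)) : ℝ) ^ (2 : ℝ≥0∞).toReal⁻¹
  have hm : 0 ≤ m := by positivity
  refine ⟨m * (‖K‖ * M) + 1, by positivity, fun y₀ => ?_⟩
  have hc : Continuous fun t => K (T (max t 0) y₀) := K.continuous.comp (hT.continuous_apply y₀)
  have hb : ∀ᵐ t ∂(volume.restrict (Set.Ioc 0 τ)), ‖K (T (max t 0) y₀)‖ ≤ ‖K‖ * M * ‖y₀‖ := by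
    filter_upwards [ae_restrict_mem measurableSet_Ioc] with t ht
    rw [max_eq_left ht.1.le, mul_assoc]
    exact K.le_opNorm_of_le ((T t).le_of_opNorm_le (hM t ht.1.le ht.2) _)
  have hL : MemLp (fun t => K (T (max t 0) y₀)) 2 (volume.restrict (Set.Ioc 0 τ)) :=
    MemLp.of_bound hc.aestronglyMeasurable _ hb
  refine ⟨hL.toLp _, ?_, ?_⟩
  · have e : endState S B τ y₀ (hL.toLp _) = T τ y₀ := by
      have h1 := mild_of_generates_closedLoop hA h hK.freeze hT hτ y₀
      rw [max_eq_left hτ] at h1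
      rw [h1]
      change mild S y₀ (fun t => B (hL.toLp _ t)) τ = _
      refine mild_congr hτ ?_
      filter_upwards [hL.coeFn_toLp] with t ht
      rw [ht]
    rw [e]
    exact (T τ).le_of_opNorm_le hα y₀
  · have hb' : ∀ᵐ t ∂(volume.restrict (Set.Ioc 0 τ)), ‖hL.toLp _ t‖ ≤ ‖K‖ * M * ‖y₀‖ := by
      filter_upwards [hb, hL.coeFn_toLp] with t h1 h2
      rwa [h2]
    have h1 := Lp.norm_le_of_ae_bound (by positivity) hb'
    have h2 : m * (‖K‖ * M * ‖y₀‖) ≤ (m * (‖K‖ * M) + 1) * ‖y₀‖ := by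
      nlinarith [norm_nonneg y₀]
    exact h1.trans h2

/-- Only times `τ - t ≥ 0` enter the integral, so freezing the semigroup at negative times is
harmless; the same holds for the observation and the Gramian. -/
theorem endState_freeze {τ : ℝ} (hτ : 0 ≤ τ) (y₀ : X) (u : Control U τ) :
    endState (fun t => S (max t 0)) B τ y₀ u = endState S B τ y₀ u := by
  let _ : NormedSpace ℝ X := NormedSpace.restrictScalars ℝ 𝕜 X
  simp only [endState, max_eq_left hτ]
  congr 1
  refine intervalIntegral.integral_congr fun t ht => ?_
  rw [Set.uIcc_of_le hτ] at ht
  simp only [max_eq_left (sub_nonneg.2 ht.2)]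

theorem obsNorm_freeze {τ : ℝ} (hτ : 0 ≤ τ) (ψ : X) :
    obsNorm (fun t => S (max t 0)) B τ ψ = obsNorm S B τ ψ := by
  unfold obsNorm
  congr 1
  refine intervalIntegral.integral_congr fun t ht => ?_
  rw [Set.uIcc_of_le hτ] at ht
  simp only [max_eq_left (sub_nonneg.2 ht.2)]

theorem gramian_freeze {τ : ℝ} (hτ : 0 ≤ τ) (ψ : X) :
    gramian (fun t => S (max t 0)) B τ ψ = gramian S B τ ψ := by
  let _ : NormedSpace ℝ X := NormedSpace.restrictScalars ℝ 𝕜 X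
  unfold gramian
  refine intervalIntegral.integral_congr fun t ht => ?_
  rw [Set.uIcc_of_le hτ] at ht
  simp only [max_eq_left (sub_nonneg.2 ht.2)]

theorem steersWithCost_freeze {τ α C : ℝ} (hτ : 0 ≤ τ) :
    SteersWithCost (fun t => S (max t 0)) B τ α C ↔ SteersWithCost S B τ α C := by
  simp only [SteersWithCost, endState_freeze hτ]

theorem weakObservability_freeze {τ α C : ℝ} (hτ : 0 ≤ τ) :
    WeakObservability (fun t => S (max t 0)) B τ α C ↔ WeakObservability S B τ α C := by
  simp only [WeakObservability, obsNorm_freeze hτ, max_eq_left hτ]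

theorem mu_freeze {τ α : ℝ} (hτ : 0 ≤ τ) :
    mu (fun t => S (max t 0)) B τ α = mu S B τ α := by
  simp only [mu, muAt, gramianNorm, gramian_freeze hτ, max_eq_left hτ]

end Rates

/-! ### Stabilizability and the best decay rate. -/

section Main

variable {𝕜 X U : Type*} [RCLike 𝕜]
  [NormedAddCommGroup X] [InnerProductSpace 𝕜 X] [CompleteSpace X]
  [NormedAddCommGroup U] [InnerProductSpace 𝕜 U] [CompleteSpace U]
  {A : X →ₗ.[𝕜] X} {S T : ℝ → X →L[𝕜] X} {B : U →L[𝕜] X} {K : X →L[𝕜] U}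

theorem steersWithCost_iff_weakObservability (hA : Generates A S) {τ α C : ℝ} (hτ : 0 ≤ τ)
    (hα : 0 ≤ α) (hC : 0 ≤ C) : SteersWithCost S B τ α C ↔ WeakObservability S B τ α C := by
  rw [← steersWithCost_freeze hτ, ← weakObservability_freeze hτ]
  exact steersWithCost_iff hA.isC0Semigroup.jointSemigroup B hτ hα hC

theorem mu_lt_top_iff_weakObservability (hA : Generates A S) {τ α : ℝ} (hτ : 0 ≤ τ)
    (hα : 0 ≤ α) : mu S B τ α < ⊤ ↔ ∃ C : ℝ, 0 < C ∧ WeakObservability S B τ α C := by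
  rw [← mu_freeze hτ]
  simp only [← weakObservability_freeze hτ (S := S)]
  exact mu_lt_top_iff hA.isC0Semigroup.jointSemigroup B hτ hα

theorem mu_lt_top_iff_steersWithCost (hA : Generates A S) {τ α : ℝ} (hτ : 0 ≤ τ)
    (hα : 0 ≤ α) : mu S B τ α < ⊤ ↔ ∃ C : ℝ, 0 < C ∧ SteersWithCost S B τ α C := by
  rw [mu_lt_top_iff_weakObservability hA hτ hα]
  exact exists_congr fun C => and_congr_right fun hC =>
    (steersWithCost_iff_weakObservability hA hτ hα hC.le).symm

theorem isLeast_mu_weakObservability (hA : Generates A S) {τ α : ℝ} (hτ : 0 ≤ τ)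
    (hα : 0 ≤ α) (H : mu S B τ α < ⊤) :
    IsLeast {C : ℝ | 0 ≤ C ∧ WeakObservability S B τ α C} (mu S B τ α).toReal := by
  rw [← mu_freeze hτ] at H ⊢
  simp only [← weakObservability_freeze hτ (S := S)]
  exact isLeast_weakObservability hA.isC0Semigroup.jointSemigroup B hτ hα H

theorem isLeast_mu_steersWithCost (hA : Generates A S) {τ α : ℝ} (hτ : 0 ≤ τ)
    (hα : 0 ≤ α) (H : mu S B τ α < ⊤) :
    IsLeast {C : ℝ | 0 ≤ C ∧ SteersWithCost S B τ α C} (mu S B τ α).toReal := by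
  have e : {C : ℝ | 0 ≤ C ∧ SteersWithCost S B τ α C} =
      {C : ℝ | 0 ≤ C ∧ WeakObservability S B τ α C} :=
    Set.ext fun C => and_congr_right fun hC => steersWithCost_iff_weakObservability hA hτ hα hC
  rw [e]
  exact isLeast_mu_weakObservability hA hτ hα H

theorem exists_feedback_of_mu_lt_top (hA : Generates A S) {τ α δ : ℝ} (hτ : 0 < τ) (hα : 0 < α)
    (hδ : 0 ≤ δ) (hαδ : Real.log α / τ < -δ) (H : mu S B τ α < ⊤) :
    ∃ (K : X →L[𝕜] U) (T : ℝ → X →L[𝕜] X), Generates (closedLoop A B K) T ∧ HasGrowthRate T (-δ) := by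
  obtain ⟨C, hC, hobs⟩ := (mu_lt_top_iff_weakObservability hA hτ.le hα.le).1 H
  refine exists_feedback_of_weakObservability hA.freeze hA.isC0Semigroup.jointSemigroup hτ hα.le
    hC.le hδ ?_ ((weakObservability_freeze hτ.le).2 hobs)
  rw [div_lt_iff₀ hτ] at hαδ
  calc Real.exp (δ * τ) * α = Real.exp (δ * τ + Real.log α) := by rw [Real.exp_add, Real.exp_log hα]
    _ < Real.exp 0 := Real.exp_lt_exp.2 (by linarith)
    _ = 1 := Real.exp_zero

theorem mu_lt_top_of_generates_closedLoop (hA : Generates A S) (hK : Generates (closedLoop A B K) T)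
    {τ α : ℝ} (hτ : 0 ≤ τ) (hα : ‖T τ‖ ≤ α) : mu S B τ α < ⊤ := by
  obtain ⟨C, hC, hst⟩ := steersWithCost_of_generates_closedLoop hA.freeze
    hA.isC0Semigroup.jointSemigroup hK hτ hα
  exact (mu_lt_top_iff_steersWithCost hA hτ ((norm_nonneg _).trans hα)).2
    ⟨C, hC, (steersWithCost_freeze hτ).1 hst⟩

/-- A negative growth rate beats every prefactor at large times. -/
theorem exists_time_exp_lt {M ω β : ℝ} (hω : ω < 0) (hβ : 0 < β) :
    ∃ τ : ℝ, 0 < τ ∧ M * Real.exp (ω * τ) < β := by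
  have h1 : Tendsto (fun τ : ℝ => M * Real.exp (ω * τ)) atTop (𝓝 (M * 0)) :=
    (Real.tendsto_exp_atBot.comp (tendsto_id.const_mul_atTop_of_neg hω)).const_mul M
  rw [mul_zero] at h1
  obtain ⟨τ, h2, h3⟩ := ((h1.eventually_lt_const hβ).and (eventually_gt_atTop 0)).exists
  exact ⟨τ, h3, h2⟩

theorem exists_mu_lt_top_of_stabilizable (hA : Generates A S) (H : ExponentiallyStabilizable A B)
    {α : ℝ} (hα : 0 < α) : ∃ τ : ℝ, 0 < τ ∧ mu S B τ α < ⊤ := by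
  obtain ⟨K, T, hK, ω, hω, M, hM1, hM⟩ := H
  obtain ⟨τ, hτ, hlt⟩ := exists_time_exp_lt (M := M) hω hα
  exact ⟨τ, hτ, mu_lt_top_of_generates_closedLoop hA hK hτ.le ((hM τ hτ.le).trans hlt.le)⟩

theorem stabilizable_of_mu_lt_top (hA : Generates A S) {τ α : ℝ} (hτ : 0 < τ) (hα : 0 < α)
    (hα1 : α < 1) (H : mu S B τ α < ⊤) : ExponentiallyStabilizable A B := by
  have hneg : Real.log α / τ < 0 := div_neg_of_neg_of_pos (Real.log_neg hα hα1) hτ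
  -- Half of the rate `-ln α / τ` leaves the strict inequality needed for the feedback.
  obtain ⟨K, T, hK, hg⟩ := exists_feedback_of_mu_lt_top hA hτ hα (δ := -(Real.log α / τ) / 2)
    (by linarith) (by linarith) H
  exact ⟨K, T, hK, _, by linarith, hg⟩

theorem bestDecayRate_le (hA : Generates A S) {τ α : ℝ} (hτ : 0 < τ) (hα : 0 < α)
    (hα1 : α < 1) (H : mu S B τ α < ⊤) :
    bestDecayRate A B ≤ ((Real.log α / τ : ℝ) : EReal) := by
  have hneg : Real.log α / τ < 0 := div_neg_of_neg_of_pos (Real.log_neg hα hα1) hτ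
  refine EReal.le_of_forall_lt_iff_le.1 fun q hq => ?_
  rw [EReal.coe_lt_coe_iff] at hq
  -- The rate `ln α / τ` itself need not be attained, so any `q` above it is tested; the minimum
  -- with `0` ensures `δ ≥ 0`.
  have hlt : Real.log α / τ < min q 0 := lt_min hq hneg
  obtain ⟨K, T, hK, hg⟩ := exists_feedback_of_mu_lt_top hA hτ hα (δ := -min q 0)
    (by simp) (by simpa using ⟨hq, hneg⟩) H
  rw [neg_neg] at hg
  calc bestDecayRate A B ≤ growthBound T := sInf_le ⟨K, T, hK, rfl⟩
    _ ≤ ((min q 0 : ℝ) : EReal) := sInf_le ⟨_, hg, rfl⟩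
    _ ≤ q := EReal.coe_le_coe_iff.2 (min_le_left _ _)

theorem sInf_log_div_le_of_hasGrowthRate (hA : Generates A S)
    (hK : Generates (closedLoop A B K) T) {ω : ℝ} (hω : ω < 0) (hg : HasGrowthRate T ω) :
    sInf {r : EReal | ∃ α τ : ℝ, 0 < α ∧ α < 1 ∧ 0 < τ ∧ mu S B τ α < ⊤ ∧
      r = ((Real.log α / τ : ℝ) : EReal)} ≤ (ω : EReal) := by
  obtain ⟨M, hM1, hM⟩ := hg
  have hM0 : 0 < M := by linarith
  refine EReal.le_of_forall_lt_iff_le.1 fun q hq => ?_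
  rw [EReal.coe_lt_coe_iff] at hq
  -- With `α = M e^{ωτ}`, the exponent `ω` ensures `α < 1`, and the exponent `ω - q` ensures `ω + ln
  -- M / τ ≤ q`.
  obtain ⟨τ, hτ, hlt⟩ := exists_time_exp_lt (M := M) (ω := max ω (ω - q))
    (max_lt hω (by linarith)) one_pos
  have h1 : M * Real.exp (ω * τ) < 1 := lt_of_le_of_lt (by gcongr; exact le_max_left _ _) hlt
  have h2 : M * Real.exp ((ω - q) * τ) < 1 := lt_of_le_of_lt (by gcongr; exact le_max_right _ _) hlt
  refine le_trans (sInf_le (a := ((Real.log (M * Real.exp (ω * τ)) / τ : ℝ) : EReal))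
    ⟨M * Real.exp (ω * τ), τ, by positivity, h1, hτ,
    mu_lt_top_of_generates_closedLoop hA hK hτ.le (hM τ hτ.le), rfl⟩) ?_
  rw [EReal.coe_le_coe_iff, div_le_iff₀ hτ, Real.log_mul hM0.ne' (Real.exp_pos _).ne', Real.log_exp]
  have h3 := Real.log_neg (by positivity) h2
  rw [Real.log_mul hM0.ne' (Real.exp_pos _).ne', Real.log_exp] at h3
  linarith

theorem bestDecayRate_eq (hA : Generates A S) (H : ExponentiallyStabilizable A B) :
    bestDecayRate A B = sInf {r : EReal | ∃ α τ : ℝ, 0 < α ∧ α < 1 ∧ 0 < τ ∧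
      mu S B τ α < ⊤ ∧ r = ((Real.log α / τ : ℝ) : EReal)} := by
  refine le_antisymm (le_sInf ?_) (le_sInf ?_)
  · rintro _ ⟨α, τ, hα, hα1, hτ, hmu, rfl⟩
    exact bestDecayRate_le hA hτ hα hα1 hmu
  · rintro _ ⟨K, T, hK, rfl⟩
    refine le_sInf ?_
    rintro _ ⟨ω, hg, rfl⟩
    rcases lt_or_ge ω 0 with hω | hω
    · exact sInf_log_div_le_of_hasGrowthRate hA hK hω hg
    -- A nonnegative growth rate yields no admissible `α` directly; the stabilizing feedback already
    -- bounds the infimum by a negative number.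
    · obtain ⟨K₀, T₀, hK₀, ω₀, hω₀, hg₀⟩ := H
      exact (sInf_log_div_le_of_hasGrowthRate hA hK₀ hω₀ hg₀).trans
        (EReal.coe_le_coe_iff.2 (hω₀.le.trans hω))

end Main

end ControlSystem

end

theorem theorem3 {𝕜 X U : Type*} [RCLike 𝕜]
    [NormedAddCommGroup X] [InnerProductSpace 𝕜 X] [CompleteSpace X]
    [NormedAddCommGroup U] [InnerProductSpace 𝕜 U] [CompleteSpace U]
    (A : X →ₗ.[𝕜] X) (S : ℝ → X →L[𝕜] X) (hA : ControlSystem.Generates A S) (B : U →L[𝕜] X) :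
    List.TFAE [
      ControlSystem.ExponentiallyStabilizable A B,
      ∀ α : ℝ, 0 < α → α < 1 → ∃ T : ℝ, 0 < T ∧ ControlSystem.mu S B T α < ⊤,
      ∃ α : ℝ, 0 < α ∧ α < 1 ∧ ∃ T : ℝ, 0 < T ∧ ControlSystem.mu S B T α < ⊤,
      ∀ α : ℝ, 0 < α → α < 1 → ∃ T : ℝ, 0 < T ∧ ∃ C : ℝ, 0 < C ∧
        ControlSystem.SteersWithCost S B T α C,
      ∃ α : ℝ, 0 < α ∧ α < 1 ∧ ∃ T : ℝ, 0 < T ∧ ∃ C : ℝ, 0 < C ∧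
        ControlSystem.SteersWithCost S B T α C,
      ∀ α : ℝ, 0 < α → α < 1 → ∃ T : ℝ, 0 < T ∧ ∃ C : ℝ, 0 < C ∧
        ControlSystem.WeakObservability S B T α C,
      ∃ α : ℝ, 0 < α ∧ α < 1 ∧ ∃ T : ℝ, 0 < T ∧ ∃ C : ℝ, 0 < C ∧
        ControlSystem.WeakObservability S B T α C] ∧
    (∀ α T : ℝ, 0 < α → α < 1 → 0 < T →
      (ControlSystem.mu S B T α < ⊤ ∨
        (∃ C : ℝ, 0 < C ∧ ControlSystem.SteersWithCost S B T α C) ∨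
        (∃ C : ℝ, 0 < C ∧ ControlSystem.WeakObservability S B T α C)) →
      ControlSystem.mu S B T α < ⊤ ∧
      IsLeast {C : ℝ | 0 ≤ C ∧ ControlSystem.SteersWithCost S B T α C}
        (ControlSystem.mu S B T α).toReal ∧
      IsLeast {C : ℝ | 0 ≤ C ∧ ControlSystem.WeakObservability S B T α C}
        (ControlSystem.mu S B T α).toReal) ∧
    (ControlSystem.ExponentiallyStabilizable A B →
      ControlSystem.bestDecayRate A B =
        sInf {r : EReal | ∃ α T : ℝ, 0 < α ∧ α < 1 ∧ 0 < T ∧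
          ControlSystem.mu S B T α < ⊤ ∧ r = ((Real.log α / T : ℝ) : EReal)}) := by
  have hst : ∀ {α T : ℝ}, 0 < α → 0 < T → (ControlSystem.mu S B T α < ⊤ ↔
      ∃ C : ℝ, 0 < C ∧ ControlSystem.SteersWithCost S B T α C) := fun hα hT =>
    ControlSystem.mu_lt_top_iff_steersWithCost hA hT.le hα.le
  have hwo : ∀ {α T : ℝ}, 0 < α → 0 < T → (ControlSystem.mu S B T α < ⊤ ↔
      ∃ C : ℝ, 0 < C ∧ ControlSystem.WeakObservability S B T α C) := fun hα hT =>
    ControlSystem.mu_lt_top_iff_weakObservability hA hT.le hα.le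
  refine ⟨?_, fun α T hα _ hT H => ?_, ControlSystem.bestDecayRate_eq hA⟩
  · tfae_have 1 → 2 := fun H α hα _ => ControlSystem.exists_mu_lt_top_of_stabilizable hA H hα
    tfae_have 2 → 3 := fun H => ⟨1 / 2, by norm_num, by norm_num, H _ (by norm_num) (by norm_num)⟩
    tfae_have 3 → 1 := fun ⟨_, hα, hα1, _, hT, H⟩ =>
      ControlSystem.stabilizable_of_mu_lt_top hA hT hα hα1 H
    tfae_have 2 ↔ 4 := forall_congr' fun _ => forall_congr' fun hα => forall_congr' fun _ =>
      exists_congr fun _ => and_congr_right fun hT => hst hα hT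
    tfae_have 3 ↔ 5 := exists_congr fun _ => and_congr_right fun hα => and_congr_right fun _ =>
      exists_congr fun _ => and_congr_right fun hT => hst hα hT
    tfae_have 2 ↔ 6 := forall_congr' fun _ => forall_congr' fun hα => forall_congr' fun _ =>
      exists_congr fun _ => and_congr_right fun hT => hwo hα hT
    tfae_have 3 ↔ 7 := exists_congr fun _ => and_congr_right fun hα => and_congr_right fun _ =>
      exists_congr fun _ => and_congr_right fun hT => hwo hα hT
    tfae_finish
  · have hmu : ControlSystem.mu S B T α < ⊤ := by
      rcases H with H | H | H
      · exact H
      · exact (hst hα hT).2 H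
      · exact (hwo hα hT).2 H
    exact ⟨hmu, ControlSystem.isLeast_mu_steersWithCost hA hT.le hα.le hmu,
      ControlSystem.isLeast_mu_weakObservability hA hT.le hα.le hmu⟩
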